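/- Let $\Phi$ be the standard normal distribution function. Let $X=(X_1,\dots,X_p)$ be a random vector with marginal distribution functions $F_1,\dots,F_p$, put $h_j=\Phi^{-1}\circ F_j$, and assume that $h(X)=(h_1(X_1),\dots,h_p(X_p))\sim N(\mu,\Sigma)$ with $\mu=0$ and $\Sigma=(\sigma_{jk})$, $\sigma_{jj}=1$ for all $j$. Let $X^1,\dots,X^n$ be independent copies of $X$, let $\tilde F_j(x)=n^{-1}\#\{i: X^i_j\le x\}$ be the empirical distribution function of the $j$-th feature, let $\hat F_j$ be $\tilde F_j$ Winsorized at $(1/n^2,\,1-1/n^2)$, that is, $\hat F_j=\min\{\max\{\tilde F_j,1/n^2\},1-1/n^2\}$, and put $\hat h_j=\Phi^{-1}\circ\hat F_j$. Let $$\hat\mu_j=\frac1n\sum_{i=1}^n\hat h_j(X^i_j),\qquad \hat\sigma_{jk}=\frac1n\sum_{i=1}^n\{\hat h_j(X^i_j)-\hat\mu_j\}\{\hat h_k(X^i_k)-\hat\mu_k\}.$$ For constants $c,C>0$ define $$\zeta_1^*(\epsilon)=2e^{-cn\epsilon^2}+4e^{-cn^{1-2\rho}\epsilon^2/\rho}+4e^{-cn^{1/2-\rho}},$$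 $$\zeta_2^*(\epsilon)=Ce^{-cn\epsilon^2}+Ce^{-cn^{1/3-\rho}}+Ce^{-cn^{1-\rho}}+Ce^{-c(\log n)^2n^{1-2\rho}\epsilon^2/\rho^2}.$$ Theorem. There are universal constants $c,C>0$ and $N\in\mathbb N$ such that for every $0<\rho<1/3$ there exists $\epsilon_0>0$ for which the following holds: for every $p$ and every $X$ as above, every $n\ge N$, every $0<\epsilon<\epsilon_0$ and all $1\le j,k\le p$, $$\Pr(|\hat\mu_j-\mu_j|>\epsilon)\le\zeta_1^*(\epsilon),\qquad \Pr(|\hat\sigma_{jk}-\sigma_{jk}|>\epsilon)\le\zeta_2^*(\epsilon).$$ -/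

import Mathlib

open MeasureTheory ProbabilityTheory

noncomputable section

namespace GaussianCopula

/-- The standard normal distribution function `Φ`. -/
def stdNormalCDF (t : ℝ) : ℝ := cdf (gaussianReal 0 1) t

/-- The standard normal quantile function `Φ⁻¹`. For `0 < q < 1` this is the inverse of `Φ`
(outside this interval the value is a meaningless default; it is never relevant, because a sample
almost surely has `0 < F_j(X_j) < 1` and the Winsorized values lie in `(0, 1)` for `n ≥ 2`). -/
def stdNormalQuantile (q : ℝ) : ℝ := sInf {t : ℝ | q ≤ stdNormalCDF t}

variable {p n : ℕ}

/-- The distribution function `F_j` of the `j`-th coordinate of a random vector with law `ν`. -/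
def marginalCDF (ν : Measure (Fin p → ℝ)) (j : Fin p) (t : ℝ) : ℝ :=
  cdf (ν.map (fun x => x j)) t

/-- The transformation `h_j = Φ⁻¹ ∘ F_j`. -/
def trans (ν : Measure (Fin p → ℝ)) (j : Fin p) (t : ℝ) : ℝ :=
  stdNormalQuantile (marginalCDF ν j t)

/-- The vector of transformed features `h(x) = (h_1(x_1), …, h_p(x_p))`. -/
def transVec (ν : Measure (Fin p → ℝ)) (x : Fin p → ℝ) : EuclideanSpace ℝ (Fin p) :=
  WithLp.toLp 2 (fun j => trans ν j (x j))

/-- The empirical distribution function of the `j`-th feature of the sample `x 0, …, x (n-1)`. -/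
def empCDF (x : Fin n → Fin p → ℝ) (j : Fin p) (t : ℝ) : ℝ :=
  ((Finset.univ.filter (fun i : Fin n => x i j ≤ t)).card : ℝ) / (n : ℝ)

/-- Winsorization of a number `u` at the pair `(a, b)`. -/
def winsorize (a b u : ℝ) : ℝ := if b < u then b else if u < a then a else u

/-- The empirical distribution function Winsorized at `(1/n², 1 - 1/n²)`. -/
def winCDF (x : Fin n → Fin p → ℝ) (j : Fin p) (t : ℝ) : ℝ :=
  winsorize (1 / (n : ℝ) ^ 2) (1 - 1 / (n : ℝ) ^ 2) (empCDF x j t)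

/-- The estimated transformation `ĥ_j = Φ⁻¹ ∘ F̂_j`. -/
def estTrans (x : Fin n → Fin p → ℝ) (j : Fin p) (t : ℝ) : ℝ :=
  stdNormalQuantile (winCDF x j t)

/-- The sample mean `μ̂_j` of the transformed data `ĥ_j(x i j)`. -/
def sampleMean (x : Fin n → Fin p → ℝ) (j : Fin p) : ℝ :=
  (∑ i, estTrans x j (x i j)) / (n : ℝ)

/-- The sample covariance `σ̂_{jk}` of the transformed data. -/
def sampleCov (x : Fin n → Fin p → ℝ) (j k : Fin p) : ℝ :=
  (∑ i, (estTrans x j (x i j) - sampleMean x j) * (estTrans x k (x i k) - sampleMean x k)) / (n : ℝ)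

/-- The bound `ζ₁*(ε)` with constant `c` in the exponents. -/
def zetaOne (c : ℝ) (n : ℕ) (ρ ε : ℝ) : ℝ :=
  2 * Real.exp (-c * n * ε ^ 2)
    + 4 * Real.exp (-c * (n : ℝ) ^ (1 - 2 * ρ) * ε ^ 2 / ρ)
    + 4 * Real.exp (-c * (n : ℝ) ^ (1 / 2 - ρ))

/-- The bound `ζ₂*(ε)` with constant `C` in front of the exponentials and `c` in the exponents. -/
def zetaTwo (C c : ℝ) (n : ℕ) (ρ ε : ℝ) : ℝ :=
  C * Real.exp (-c * n * ε ^ 2)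
    + C * Real.exp (-c * (n : ℝ) ^ (1 / 3 - ρ))
    + C * Real.exp (-c * (n : ℝ) ^ (1 - ρ))
    + C * Real.exp (-c * (Real.log n) ^ 2 * (n : ℝ) ^ (1 - 2 * ρ) * ε ^ 2 / ρ ^ 2)

end GaussianCopula

end

namespace GaussianCopula

open Set Filter Topology

/-! Almost surely the values `h_j(X^i_j)` form an i.i.d. standard Gaussian sample without ties or
zeros, and `h_j` preserves the order of the observations. Hence `ĥ_j(X^i_j)` depends only on the
rank of `h_j(X^i_j)` and is a Winsorized normal score (`estTrans_eq_normalScore`). The unknown `F_j`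
drop out, and the problem concerns ranks of i.i.d. Gaussian pairs.

The sample mean is then not random: the scores of ranks `r` and `n - r` cancel, and only the top
score `M = maxScore n` survives, so `μ̂_j = M / n` with `M² ≤ 4 log n` (`sampleMean_eq`,
`maxScore_sq_le`).

The sample covariance is the mean product of scores minus `(M / n)²`. Replacing one observation
moves each other rank by at most one, and telescoping bounds the total change of the scores by `2M`.
The mean product thus has bounded differences `6M² / n`, and McDiarmid's inequality gives
concentration about its expectation. The bias is polylogarithmic over `√n` (`bias_le`): given that
an observation equals `t`, its rank is one plus a binomial count; near `u = Φ(t)` the quantile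
function has slope at most a logarithmic power over `u(1 - u)`; and the Gaussian integral of `1 /
(Φ(1 - Φ))` over the bulk is logarithmic.

For large `n`, if `ε` exceeds twice the bias bound, the logarithms lost to McDiarmid are beaten by
`n ^ (2ρ)` and the last term of `ζ₂*` dominates; for smaller `ε` that term is already at least 1.
The finitely many small `n`, depending on `ρ`, are absorbed by `ε₀` and the first term. -/

instance nullSingleton_stdGaussian : NullSingletonClass (gaussianReal 0 1) :=
  nullSingletonClass_gaussianReal one_ne_zero

/-! ### The standard normal distribution function -/

lemma stdNormalCDF_eq_real (t : ℝ) : stdNormalCDF t = (gaussianReal 0 1).real (Iic t) :=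
  cdf_eq_real _ t

lemma stdNormalCDF_eq_integral (t : ℝ) :
    stdNormalCDF t = ∫ x in Iic t, gaussianPDFReal 0 1 x := by
  rw [stdNormalCDF_eq_real, measureReal_def, gaussianReal_apply_eq_integral 0 one_ne_zero,
    ENNReal.toReal_ofReal]
  exact integral_nonneg fun x => gaussianPDFReal_nonneg 0 1 x

lemma continuous_stdGaussianPDF : Continuous (gaussianPDFReal 0 1) := by
  unfold gaussianPDFReal
  fun_prop

lemma hasDerivAt_stdNormalCDF (t : ℝ) : HasDerivAt stdNormalCDF (gaussianPDFReal 0 1 t) t := by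
  have hint := integrable_gaussianPDFReal 0 1
  have h : stdNormalCDF = fun s => stdNormalCDF 0 + ∫ x in (0:ℝ)..s, gaussianPDFReal 0 1 x := by
    ext s
    rw [stdNormalCDF_eq_integral, stdNormalCDF_eq_integral,
      ← intervalIntegral.integral_Iic_sub_Iic hint.integrableOn hint.integrableOn]
    ring
  rw [h]
  exact (intervalIntegral.integral_hasDerivAt_right hint.intervalIntegrable
    (continuous_stdGaussianPDF.stronglyMeasurableAtFilter _ _)
    continuous_stdGaussianPDF.continuousAt).const_add _

lemma continuous_stdNormalCDF : Continuous stdNormalCDF :=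
  continuous_iff_continuousAt.2 fun t => (hasDerivAt_stdNormalCDF t).continuousAt

lemma strictMono_stdNormalCDF : StrictMono stdNormalCDF :=
  strictMono_of_hasDerivAt_pos hasDerivAt_stdNormalCDF
    fun t => gaussianPDFReal_pos 0 1 t one_ne_zero

lemma stdNormalCDF_pos (t : ℝ) : 0 < stdNormalCDF t :=
  (cdf_nonneg _ (t - 1)).trans_lt (strictMono_stdNormalCDF (by linarith))

lemma stdNormalCDF_lt_one (t : ℝ) : stdNormalCDF t < 1 :=
  (strictMono_stdNormalCDF (lt_add_one t)).trans_le (cdf_le_one _ (t + 1))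

lemma stdNormalCDF_neg (t : ℝ) : stdNormalCDF (-t) = 1 - stdNormalCDF t := by
  have h1 : (gaussianReal 0 1).real (Iic (-t)) = (gaussianReal 0 1).real (Ici t) := by
    have h := gaussianReal_map_neg (μ := 0) (v := 1)
    rw [neg_zero] at h
    conv_lhs => rw [← h]
    rw [map_measureReal_apply measurable_neg measurableSet_Iic]
    congr 1
    ext x
    simp
  have h2 : (gaussianReal 0 1).real (Ici t) = (gaussianReal 0 1).real (Ioi t) :=
    measureReal_congr Ioi_ae_eq_Ici.symm
  have h3 := probReal_compl_eq_one_sub (μ := gaussianReal 0 1) (measurableSet_Iic (a := t))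
  rw [stdNormalCDF_eq_real, stdNormalCDF_eq_real, h1, h2, ← h3, compl_Iic]

lemma one_sub_stdNormalCDF_eq_real (t : ℝ) :
    1 - stdNormalCDF t = (gaussianReal 0 1).real (Ioi t) := by
  rw [← compl_Iic, probReal_compl_eq_one_sub measurableSet_Iic, stdNormalCDF_eq_real]

/-- The Chernoff bound: the Gaussian is sub-Gaussian with parameter 1. -/
lemma one_sub_stdNormalCDF_le {t : ℝ} (ht : 0 ≤ t) :
    1 - stdNormalCDF t ≤ Real.exp (-t ^ 2 / 2) := by
  have h : HasSubgaussianMGF id 1 (gaussianReal 0 1) :=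
    ⟨fun t => integrable_exp_mul_gaussianReal t, fun t => by
      rw [mgf_id_gaussianReal]; simp⟩
  have h2 := h.measure_ge_le ht
  rw [one_sub_stdNormalCDF_eq_real]
  calc _ ≤ (gaussianReal 0 1).real {x | t ≤ id x} :=
        measureReal_mono (show Ioi t ⊆ {x | t ≤ id x} from fun x hx => (mem_Ioi.1 hx).le)
    _ ≤ _ := by simpa using h2

lemma stdNormalCDF_mul_one_sub_le (t : ℝ) :
    stdNormalCDF t * (1 - stdNormalCDF t) ≤ Real.exp (-t ^ 2 / 2) := by
  have h0 := stdNormalCDF_pos t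
  have h1 := stdNormalCDF_lt_one t
  rcases le_total 0 t with ht | ht
  · have := one_sub_stdNormalCDF_le ht
    nlinarith
  · have := one_sub_stdNormalCDF_le (neg_nonneg.2 ht)
    rw [stdNormalCDF_neg, neg_sq] at this
    nlinarith

lemma stdGaussianPDF_eq (t : ℝ) :
    gaussianPDFReal 0 1 t = (√(2 * Real.pi))⁻¹ * Real.exp (-t ^ 2 / 2) := by
  simp [gaussianPDFReal]

lemma third_le_inv_sqrt_two_pi : 1 / 3 ≤ (√(2 * Real.pi))⁻¹ := by
  rw [one_div]
  apply inv_anti₀ (by positivity)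
  rw [Real.sqrt_le_left (by norm_num)]
  nlinarith [Real.pi_lt_four]

/-! ### The standard normal quantile function -/

lemma exists_stdNormalCDF_eq {u : ℝ} (h0 : 0 < u) (h1 : u < 1) : ∃ t, stdNormalCDF t = u := by
  have ha : ∃ a, stdNormalCDF a < u :=
    ((tendsto_cdf_atBot (gaussianReal 0 1)).eventually_lt_const h0).exists
  have hb : ∃ b, u < stdNormalCDF b :=
    ((tendsto_cdf_atTop (gaussianReal 0 1)).eventually_const_lt h1).exists
  obtain ⟨a, ha⟩ := ha
  obtain ⟨b, hb⟩ := hb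
  exact mem_range_of_exists_le_of_exists_ge continuous_stdNormalCDF ⟨a, ha.le⟩ ⟨b, hb.le⟩

lemma stdNormalQuantile_stdNormalCDF (t : ℝ) : stdNormalQuantile (stdNormalCDF t) = t := by
  have : {s : ℝ | stdNormalCDF t ≤ stdNormalCDF s} = Ici t := by
    ext s
    exact strictMono_stdNormalCDF.le_iff_le
  rw [stdNormalQuantile, this, csInf_Ici]

lemma stdNormalCDF_stdNormalQuantile {u : ℝ} (h0 : 0 < u) (h1 : u < 1) :
    stdNormalCDF (stdNormalQuantile u) = u := by
  obtain ⟨t, rfl⟩ := exists_stdNormalCDF_eq h0 h1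
  rw [stdNormalQuantile_stdNormalCDF]

lemma stdNormalQuantile_mono {u v : ℝ} (h0 : 0 < u) (huv : u ≤ v) (h1 : v < 1) :
    stdNormalQuantile u ≤ stdNormalQuantile v := by
  rw [← strictMono_stdNormalCDF.le_iff_le, stdNormalCDF_stdNormalQuantile h0 (huv.trans_lt h1),
    stdNormalCDF_stdNormalQuantile (h0.trans_le huv) h1]
  exact huv

lemma stdNormalQuantile_one_sub {u : ℝ} (h0 : 0 < u) (h1 : u < 1) :
    stdNormalQuantile (1 - u) = -stdNormalQuantile u := by
  obtain ⟨t, rfl⟩ := exists_stdNormalCDF_eq h0 h1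
  rw [← stdNormalCDF_neg, stdNormalQuantile_stdNormalCDF, stdNormalQuantile_stdNormalCDF]

/-- Here and at 1 the infimum is over a set where `sInf` takes its default value 0. A nonzero
quantile therefore certifies that the argument is neither 0 nor 1. -/
lemma stdNormalQuantile_zero : stdNormalQuantile 0 = 0 := by
  have : {t : ℝ | 0 ≤ stdNormalCDF t} = univ := eq_univ_of_forall fun t => (stdNormalCDF_pos t).le
  rw [stdNormalQuantile, this, Real.sInf_univ]

lemma stdNormalQuantile_one : stdNormalQuantile 1 = 0 := by
  have : {t : ℝ | 1 ≤ stdNormalCDF t} = ∅ :=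
    eq_empty_of_forall_notMem fun t => not_le.2 (stdNormalCDF_lt_one t)
  rw [stdNormalQuantile, this, Real.sInf_empty]

/-- Two points of `[-M, M]` are controlled by their images under `Φ`. -/
lemma abs_sub_mul_le_abs_stdNormalCDF_sub {M s t : ℝ} (hs : |s| ≤ M) (ht : |t| ≤ M) :
    |s - t| * (stdNormalCDF t * (1 - stdNormalCDF t)) ≤
      18 * (1 + M) ^ 2 * |stdNormalCDF s - stdNormalCDF t| := by
  have hM : 0 ≤ M := (abs_nonneg s).trans hs
  -- Within distance `1 / (1 + M)` of `t` the exponent `r² / 2` grows by at most 1, costing a factor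
  -- `e < 3`; the other factor 3 bounds `√(2π)`.
  have key : ∀ r, |r - t| ≤ 1 / (1 + M) →
      Real.exp (-t ^ 2 / 2) / 9 ≤ gaussianPDFReal 0 1 r := by
    intro r hr
    have h1 : |r - t| * (1 + M) ≤ 1 := by rwa [le_div_iff₀ (by linarith)] at hr
    have h2 : r ^ 2 ≤ t ^ 2 + 2 := by
      have e1 : r ^ 2 - t ^ 2 = (r - t) * ((r - t) + 2 * t) := by ring
      have e2 : (r - t) * ((r - t) + 2 * t) ≤ |r - t| * (|r - t| + 2 * |t|) := by
        have h2t := mul_le_mul_of_nonneg_left (le_abs_self (t * (r - t))) zero_le_two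
        rw [abs_mul] at h2t
        nlinarith [sq_abs (r - t)]
      have h3 : |r - t| ≤ 1 := by
        nlinarith [mul_nonneg (abs_nonneg (r - t)) hM]
      have h4 := mul_le_mul_of_nonneg_left ht (abs_nonneg (r - t))
      have h5 := mul_le_mul_of_nonneg_left h3 (abs_nonneg (r - t))
      nlinarith [abs_nonneg (r - t), mul_nonneg (abs_nonneg (r - t)) hM]
    have h3 : Real.exp (-t ^ 2 / 2) ≤ 3 * Real.exp (-r ^ 2 / 2) := by
      have : Real.exp (-t ^ 2 / 2) ≤ Real.exp (1 + -r ^ 2 / 2) := Real.exp_le_exp.2 (by linarith)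
      rw [Real.exp_add] at this
      have he := Real.exp_one_lt_three
      nlinarith [Real.exp_pos (-r ^ 2 / 2)]
    rw [stdGaussianPDF_eq]
    nlinarith [third_le_inv_sqrt_two_pi, Real.exp_pos (-r ^ 2 / 2)]
  have hpos : 0 < 1 + M := by linarith
  -- Since `|s - t| ≤ 2M`, going the fraction `θ` of the way from `t` to `s` stays where the density
  -- bound holds; monotonicity of `Φ` covers the rest of the way.
  set θ : ℝ := 1 / (2 * (1 + M) ^ 2) with hθ
  have hθ0 : 0 < θ := by positivity
  have hθ1 : θ ≤ 1 := by
    rw [hθ, div_le_one (by positivity)]; nlinarith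
  set E : ℝ := Real.exp (-t ^ 2 / 2) / 9
  have hE0 : 0 < E := by positivity
  have hst : |s - t| ≤ 2 * M := by
    calc |s - t| ≤ |s| + |t| := abs_sub s t
      _ ≤ 2 * M := by linarith
  have hη : θ * |s - t| ≤ 1 / (1 + M) := by
    calc θ * |s - t| ≤ θ * (2 * (1 + M)) := by gcongr; linarith
      _ = 1 / (1 + M) := by rw [hθ]; field_simp
  have mvt : ∀ a b, a ≤ b → (∀ r ∈ Icc a b, |r - t| ≤ 1 / (1 + M)) →
      E * (b - a) ≤ stdNormalCDF b - stdNormalCDF a := by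
    intro a b hab hr
    apply (convex_Icc a b).mul_sub_le_image_sub_of_le_deriv
      continuous_stdNormalCDF.continuousOn
      (fun x _ => (hasDerivAt_stdNormalCDF x).differentiableAt.differentiableWithinAt)
    · intro x hx
      rw [(hasDerivAt_stdNormalCDF x).deriv]
      exact key x (hr x (interior_subset hx))
    · exact ⟨le_rfl, hab⟩
    · exact ⟨hab, le_rfl⟩
    · exact hab
  have main : E * (θ * |s - t|) ≤ |stdNormalCDF s - stdNormalCDF t| := by
    have hle : θ * |s - t| ≤ |s - t| := mul_le_of_le_one_left (abs_nonneg _) hθ1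
    have h0 : 0 ≤ θ * |s - t| := by positivity
    rcases le_total t s with h | h
    · have e : |s - t| = s - t := abs_of_nonneg (by linarith)
      have := mvt t (t + θ * |s - t|) (by linarith) (fun r hr => by
        rw [abs_of_nonneg (by linarith [hr.1])]; linarith [hr.2])
      have hm := strictMono_stdNormalCDF.monotone
        (show t + θ * |s - t| ≤ s by rw [e] at hle ⊢; linarith)
      rw [abs_of_nonneg (a := stdNormalCDF s - _)
        (sub_nonneg.2 (strictMono_stdNormalCDF.monotone h))]
      rw [add_sub_cancel_left] at this
      linarith
    · have e : |s - t| = t - s := by rw [abs_sub_comm]; exact abs_of_nonneg (by linarith)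
      have := mvt (t - θ * |s - t|) t (by linarith) (fun r hr => by
        rw [abs_sub_comm, abs_of_nonneg (by linarith [hr.2])]; linarith [hr.1])
      have hm := strictMono_stdNormalCDF.monotone
        (show s ≤ t - θ * |s - t| by rw [e] at hle ⊢; linarith)
      rw [abs_sub_comm (stdNormalCDF s), abs_of_nonneg (a := stdNormalCDF t - _)
        (sub_nonneg.2 (strictMono_stdNormalCDF.monotone h))]
      rw [sub_sub_cancel] at this
      linarith
  have hΦ : stdNormalCDF t * (1 - stdNormalCDF t) ≤ 9 * E :=
    (stdNormalCDF_mul_one_sub_le t).trans (le_of_eq (by simp only [E]; ring))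
  calc |s - t| * (stdNormalCDF t * (1 - stdNormalCDF t)) ≤ |s - t| * (9 * E) := by gcongr
    _ = 18 * (1 + M) ^ 2 * (E * (θ * |s - t|)) := by rw [hθ]; field_simp; ring
    _ ≤ _ := by gcongr

/-! ### The method of bounded differences -/

section BoundedDifferences

variable {α : Type*} [MeasurableSpace α]

lemma integrable_of_abs_le {β : Type*} [MeasurableSpace β] {m : Measure β} [IsFiniteMeasure m]
    {f : β → ℝ} (hf : Measurable f) {B : ℝ} (hB : ∀ x, |f x| ≤ B) : Integrable f m :=
  Integrable.of_bound hf.aestronglyMeasurable B (ae_of_all _ fun x => hB x)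

lemma abs_integral_le_of_abs_le {β : Type*} [MeasurableSpace β] (m : Measure β)
    [IsProbabilityMeasure m] {f : β → ℝ} {B : ℝ} (hB : ∀ x, |f x| ≤ B) : |∫ x, f x ∂m| ≤ B := by
  have := norm_integral_le_of_norm_le_const (μ := m) (f := f) (C := B) (ae_of_all _ hB)
  simpa using this

lemma measurable_exp_mul_and_abs_le {β : Type*} [MeasurableSpace β]
    {f : β → ℝ} (hf : Measurable f) {B : ℝ} (hB : ∀ x, |f x| ≤ B) (s : ℝ) :
    Measurable (fun x => Real.exp (s * f x)) ∧
      ∀ x, |Real.exp (s * f x)| ≤ Real.exp (|s| * B) := by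
  refine ⟨by fun_prop, fun x => ?_⟩
  rw [Real.abs_exp, Real.exp_le_exp]
  calc s * f x ≤ |s * f x| := le_abs_self _
    _ = |s| * |f x| := abs_mul _ _
    _ ≤ |s| * B := by gcongr; exact hB x

/-- Hoeffding's lemma for a function of oscillation at most `c`. -/
lemma integral_exp_mul_le_of_oscillation (γ : Measure α) [IsProbabilityMeasure γ] {g : α → ℝ}
    (hg : Measurable g) {c : ℝ} (hc : ∀ x y, |g x - g y| ≤ c) (s : ℝ) :
    ∫ x, Real.exp (s * g x) ∂γ ≤ Real.exp (s * ∫ x, g x ∂γ + s ^ 2 * c ^ 2 / 2) := by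
  obtain ⟨x₀⟩ := nonempty_of_isProbabilityMeasure γ
  have hc0 : 0 ≤ c := (abs_nonneg _).trans (hc x₀ x₀)
  -- An interval around an arbitrary value `g x₀` avoids infima and suprema; its length `2c` costs a
  -- factor 4 in the variance proxy.
  have h := (hasSubgaussianMGF_of_mem_Icc (μ := γ) (X := g) (a := g x₀ - c) (b := g x₀ + c)
    hg.aemeasurable (ae_of_all _ fun x => by
      have := abs_le.1 (hc x x₀); constructor <;> linarith)).mgf_le s
  have e : (((‖g x₀ + c - (g x₀ - c)‖₊ / 2) ^ 2 : NNReal) : ℝ) = c ^ 2 := by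
    have : g x₀ + c - (g x₀ - c) = 2 * c := by ring
    rw [this]
    simp [abs_of_nonneg hc0]
  rw [e, mgf] at h
  have e2 : ∀ x, Real.exp (s * g x) =
      Real.exp (s * ∫ x, g x ∂γ) * Real.exp (s * (g x - ∫ x, g x ∂γ)) := fun x => by
    rw [← Real.exp_add]; ring_nf
  simp_rw [e2]
  rw [integral_const_mul, Real.exp_add]
  gcongr
  exact h.trans (le_of_eq (by ring_nf))

lemma integral_pi_succ (γ : Measure α) [IsProbabilityMeasure γ] {n : ℕ} (i : Fin (n + 1))
    {f : (Fin (n + 1) → α) → ℝ} (hf : Integrable f (Measure.pi fun _ => γ)) :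
    ∫ x, f x ∂(Measure.pi fun _ => γ) =
      ∫ a, ∫ y, f (i.insertNth a y) ∂(Measure.pi fun _ : Fin n => γ) ∂γ := by
  have h := (measurePreserving_piFinSuccAbove (fun _ : Fin (n + 1) => γ) i).symm
  rw [← h.integral_comp', integral_prod]
  · rfl
  · exact (h.integrable_comp hf.aestronglyMeasurable).2 hf

lemma measurable_insertNth {n : ℕ} (i : Fin (n + 1)) :
    Measurable fun q : α × (Fin n → α) => (i.insertNth q.1 q.2 : Fin (n + 1) → α) :=
  (MeasurableEquiv.piFinSuccAbove (fun _ : Fin (n + 1) => α) i).symm.measurable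

/-- Induction on `n`: averaging out all coordinates but the first leaves a function of oscillation
at most `c`, to which Hoeffding's lemma applies, while each slice falls under the induction
hypothesis. The bound `B` serves only integrability. -/
theorem integral_exp_mul_le_of_bounded_differences (γ : Measure α) [IsProbabilityMeasure γ]
    {n : ℕ} {f : (Fin n → α) → ℝ} (hf : Measurable f) {B : ℝ} (hB : ∀ x, |f x| ≤ B) {c : ℝ}
    (hc : ∀ x i y, |f (Function.update x i y) - f x| ≤ c) (s : ℝ) :
    ∫ x, Real.exp (s * f x) ∂(Measure.pi fun _ => γ) ≤
      Real.exp (s * (∫ x, f x ∂(Measure.pi fun _ => γ)) + n * (s ^ 2 * c ^ 2 / 2)) := by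
  induction n with
  | zero =>
    have h : ∀ x, f x = f default := fun x => congrArg f (Subsingleton.elim _ _)
    simp [h]
  | succ n ih =>
    obtain ⟨hm, hb⟩ := measurable_exp_mul_and_abs_le hf hB s
    rw [integral_pi_succ γ 0 (integrable_of_abs_le hm hb),
      integral_pi_succ γ 0 (integrable_of_abs_le hf hB)]
    set g : α → ℝ := fun a => ∫ y, f (Fin.insertNth 0 a y) ∂(Measure.pi fun _ : Fin n => γ)
    have hfm : Measurable fun q : α × (Fin n → α) => f (Fin.insertNth 0 q.1 q.2) :=
      hf.comp (measurable_insertNth 0)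
    have hfa : ∀ a, Measurable fun y : Fin n → α => f (Fin.insertNth 0 a y) := fun a =>
      hfm.comp (measurable_const.prodMk measurable_id)
    have hgm : Measurable g := hfm.stronglyMeasurable.integral_prod_right.measurable
    have hgB : ∀ a, |g a| ≤ B := fun a => abs_integral_le_of_abs_le _ fun y => hB _
    have hgc : ∀ a b, |g a - g b| ≤ c := by
      intro a b
      simp only [g]
      rw [← integral_sub (integrable_of_abs_le (hfa a) fun y => hB _)
        (integrable_of_abs_le (hfa b) fun y => hB _)]
      refine abs_integral_le_of_abs_le _ fun y => ?_
      have := hc (Fin.insertNth 0 b y) 0 a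
      simpa using this
    have step : ∀ a, ∫ y, Real.exp (s * f (Fin.insertNth 0 a y)) ∂(Measure.pi fun _ : Fin n => γ) ≤
        Real.exp (s * g a) * Real.exp (n * (s ^ 2 * c ^ 2 / 2)) := by
      intro a
      rw [← Real.exp_add]
      refine ih (hfa a) (fun y => hB _) ?_
      intro y i z
      have := hc (Fin.insertNth 0 a y) i.succ z
      rw [Fin.insertNth_zero', ← Fin.cons_update] at this
      simpa using this
    obtain ⟨hgm', hgb'⟩ := measurable_exp_mul_and_abs_le hgm hgB s
    calc ∫ a, ∫ y, Real.exp (s * f (Fin.insertNth 0 a y)) ∂(Measure.pi fun _ : Fin n => γ) ∂γ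
        ≤ ∫ a, Real.exp (s * g a) * Real.exp (n * (s ^ 2 * c ^ 2 / 2)) ∂γ := by
          refine integral_mono ?_ ((integrable_of_abs_le hgm' hgb').mul_const _) step
          refine integrable_of_abs_le (B := Real.exp (|s| * B))
            (Measurable.stronglyMeasurable ?_).integral_prod_right.measurable ?_
          · exact (hfm.const_mul s).exp
          · exact fun a => abs_integral_le_of_abs_le _ fun y => hb _
      _ = (∫ a, Real.exp (s * g a) ∂γ) * Real.exp (n * (s ^ 2 * c ^ 2 / 2)) :=
          integral_mul_const _ _
      _ ≤ Real.exp (s * (∫ a, g a ∂γ) + s ^ 2 * c ^ 2 / 2) * Real.exp (n * (s ^ 2 * c ^ 2 / 2)) := by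
          gcongr
          exact integral_exp_mul_le_of_oscillation γ hgm hgc s
      _ = _ := by
          rw [← Real.exp_add]
          push_cast
          ring_nf

/-- McDiarmid's inequality, with a non-optimal constant. -/
theorem measureReal_abs_sub_integral_ge_le_of_bounded_differences (γ : Measure α)
    [IsProbabilityMeasure γ] {n : ℕ} {f : (Fin n → α) → ℝ} (hf : Measurable f) {B : ℝ}
    (hB : ∀ x, |f x| ≤ B) {c : ℝ}
    (hc : ∀ x i y, |f (Function.update x i y) - f x| ≤ c) {t : ℝ} (ht : 0 ≤ t) :
    (Measure.pi fun _ : Fin n => γ).real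
        {x | t ≤ |f x - ∫ x, f x ∂(Measure.pi fun _ : Fin n => γ)|} ≤
      2 * Real.exp (-t ^ 2 / (2 * (n * c ^ 2))) := by
  set m := ∫ x, f x ∂(Measure.pi fun _ : Fin n => γ)
  have h : HasSubgaussianMGF (fun x => f x - m) (NNReal.mk (n * c ^ 2) (by positivity))
      (Measure.pi fun _ : Fin n => γ) := by
    refine ⟨fun s => ?_, fun s => ?_⟩
    · obtain ⟨h1, h2⟩ := measurable_exp_mul_and_abs_le (hf.sub_const m)
        (B := B + |m|) (fun x => (abs_sub _ _).trans (by gcongr; exact hB x)) s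
      exact integrable_of_abs_le h1 h2
    · have h1 := integral_exp_mul_le_of_bounded_differences γ hf hB hc s
      have e2 : ∀ x, Real.exp (s * (f x - m)) = Real.exp (s * f x) * Real.exp (-(s * m)) :=
        fun x => by rw [← Real.exp_add]; ring_nf
      simp_rw [mgf, e2]
      rw [integral_mul_const]
      calc _ ≤ Real.exp (s * m + n * (s ^ 2 * c ^ 2 / 2)) * Real.exp (-(s * m)) := by gcongr
        _ = _ := by
          rw [← Real.exp_add, NNReal.coe_mk]
          ring_nf
  have h1 := h.measure_ge_le ht
  have h2 := h.neg.measure_ge_le ht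
  rw [NNReal.coe_mk] at h1 h2
  calc _ ≤ (Measure.pi fun _ : Fin n => γ).real
        ({x | t ≤ f x - m} ∪ {x | t ≤ (-fun x => f x - m) x}) :=
        measureReal_mono fun x hx => by
          rcases le_abs.1 (show t ≤ |f x - m| from hx) with h | h
          · exact Or.inl h
          · exact Or.inr h
    _ ≤ _ := (measureReal_union_le _ _).trans (by linarith)

end BoundedDifferences

/-! ### Ranks -/

/-- Rank is strictly increasing in the value, hence injective; as it lies between 1 and `s.card`, it
is a bijection onto that interval. -/
lemma sum_comp_rank {ι β : Type*} [LinearOrder β] (s : Finset ι) {v : ι → β}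
    (hv : Set.InjOn v s) (g : ℕ → ℝ) :
    ∑ i ∈ s, g (s.filter fun l => v l ≤ v i).card = ∑ r ∈ Finset.Icc 1 s.card, g r := by
  have hlt : ∀ i ∈ s, ∀ j ∈ s, v i < v j →
      (s.filter fun l => v l ≤ v i).card < (s.filter fun l => v l ≤ v j).card := by
    intro i _ j hj hij
    apply Finset.card_lt_card
    refine ⟨fun l hl => ?_, fun h => ?_⟩
    · rw [Finset.mem_filter] at hl ⊢
      exact ⟨hl.1, hl.2.trans hij.le⟩
    · have := h (Finset.mem_filter.2 ⟨hj, le_rfl⟩)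
      exact absurd (Finset.mem_filter.1 this).2 (not_le.2 hij)
  have hinj : Set.InjOn (fun i => (s.filter fun l => v l ≤ v i).card) s := by
    intro i hi j hj hij
    rcases lt_trichotomy (v i) (v j) with h | h | h
    · exact absurd hij (hlt i hi j hj h).ne
    · exact hv hi hj h
    · exact absurd hij (hlt j hj i hi h).ne'
  have himg : s.image (fun i => (s.filter fun l => v l ≤ v i).card) = Finset.Icc 1 s.card := by
    apply Finset.eq_of_subset_of_card_le
    · intro r hr
      obtain ⟨i, hi, rfl⟩ := Finset.mem_image.1 hr
      rw [Finset.mem_Icc]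
      exact ⟨Finset.card_pos.2 ⟨i, Finset.mem_filter.2 ⟨hi, le_rfl⟩⟩,
        Finset.card_le_card (Finset.filter_subset _ _)⟩
    · rw [Finset.card_image_of_injOn hinj, Nat.card_Icc, Nat.add_sub_cancel]
  rw [← himg, Finset.sum_image hinj]

variable {n : ℕ}

/-- The rank of `v i` among the values of `v`, ties being broken by the index. -/
noncomputable def tieRank (v : Fin n → ℝ) (i : Fin n) : ℕ :=
  (Finset.univ.filter fun l => toLex (v l, l) ≤ toLex (v i, i)).card

/-- Breaking ties by index makes the ranks a permutation for every sample, so the bounded-difference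
estimate holds everywhere, as McDiarmid's inequality requires, and not just almost everywhere. -/
lemma toLex_pair_injective (v : Fin n → ℝ) :
    Function.Injective fun l => toLex (v l, l) := fun a b h => by
  have := congrArg (fun q => (ofLex q).2) h
  simpa using this

lemma sum_comp_tieRank (v : Fin n → ℝ) (g : ℕ → ℝ) :
    ∑ i, g (tieRank v i) = ∑ r ∈ Finset.Icc 1 n, g r := by
  have := sum_comp_rank Finset.univ ((toLex_pair_injective v).injOn) g
  simpa [tieRank] using this

lemma tieRank_eq_of_injective {v : Fin n → ℝ} (hv : Function.Injective v) (i : Fin n) :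
    tieRank v i = (Finset.univ.filter fun l => v l ≤ v i).card := by
  unfold tieRank
  congr 1
  ext l
  simp only [Finset.mem_filter, Finset.mem_univ, true_and, Prod.Lex.toLex_le_toLex]
  constructor
  · rintro (h | h)
    · exact h.le
    · exact h.1.le
  · intro h
    rcases h.lt_or_eq with h | h
    · exact Or.inl h
    · exact Or.inr ⟨h, (hv h).le⟩

/-- The rank of `v i` among the values `v l`, `l ≠ m`. -/
noncomputable def tieRankErase (m : Fin n) (v : Fin n → ℝ) (i : Fin n) : ℕ :=
  ((Finset.univ.erase m).filter fun l => toLex (v l, l) ≤ toLex (v i, i)).card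

lemma tieRankErase_le_tieRank (m : Fin n) (v : Fin n → ℝ) (i : Fin n) :
    tieRankErase m v i ≤ tieRank v i :=
  Finset.card_le_card (Finset.filter_subset_filter _ (Finset.erase_subset _ _))

lemma tieRank_le_tieRankErase_add_one (m : Fin n) (v : Fin n → ℝ) (i : Fin n) :
    tieRank v i ≤ tieRankErase m v i + 1 := by
  unfold tieRank tieRankErase
  have e : ((Finset.univ.erase m).filter fun l => toLex (v l, l) ≤ toLex (v i, i)) =
      (Finset.univ.filter fun l => toLex (v l, l) ≤ toLex (v i, i)).erase m := by
    ext l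
    simp only [Finset.mem_filter, Finset.mem_erase, Finset.mem_univ, true_and, and_true]
  rw [e]
  have := Finset.pred_card_le_card_erase (a := m)
    (s := Finset.univ.filter fun l => toLex (v l, l) ≤ toLex (v i, i))
  omega

/-- The rank with `m` erased does not see the `m`-th observation. The full ranks before and after
replacement are each this number or one more. -/
lemma tieRankErase_update {m i : Fin n} (hi : i ≠ m) (v : Fin n → ℝ) (y : ℝ) :
    tieRankErase m (Function.update v m y) i = tieRankErase m v i := by
  unfold tieRankErase
  congr 1
  apply Finset.filter_congr
  intro l hl
  rw [Function.update_of_ne hi, Function.update_of_ne (Finset.ne_of_mem_erase hl)]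

lemma sum_erase_tieRankErase (m : Fin n) (v : Fin n → ℝ) (g : ℕ → ℝ) :
    ∑ i ∈ Finset.univ.erase m, g (tieRankErase m v i) = ∑ r ∈ Finset.Icc 1 (n - 1), g r := by
  have := sum_comp_rank (Finset.univ.erase m) ((toLex_pair_injective v).injOn) g
  simpa [tieRankErase] using this

/-- Replacing one observation changes a monotone score of the ranks by a bounded amount in total. -/
lemma sum_erase_abs_tieRank_update_sub_le {w : ℕ → ℝ} (hw : Monotone w) {M : ℝ}
    (hM : ∀ r, |w r| ≤ M) (m : Fin n) (v : Fin n → ℝ) (y : ℝ) :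
    ∑ i ∈ Finset.univ.erase m, |w (tieRank (Function.update v m y) i) - w (tieRank v i)| ≤
      2 * M := by
  calc _ ≤ ∑ i ∈ Finset.univ.erase m, (w (tieRankErase m v i + 1) - w (tieRankErase m v i)) := by
        refine Finset.sum_le_sum fun i hi => ?_
        have h1 := hw (tieRankErase_le_tieRank m v i)
        have h2 := hw (tieRank_le_tieRankErase_add_one m v i)
        have h3 := hw (tieRankErase_le_tieRank m (Function.update v m y) i)
        have h4 := hw (tieRank_le_tieRankErase_add_one m (Function.update v m y) i)
        rw [tieRankErase_update (Finset.ne_of_mem_erase hi)] at h3 h4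
        rw [abs_le]
        constructor <;> linarith
    -- The erased rank takes each value `1, …, n - 1` once, so the increments telescope.
    _ = ∑ r ∈ Finset.Icc 1 (n - 1), (w (r + 1) - w r) :=
        sum_erase_tieRankErase m v fun r => w (r + 1) - w r
    _ = w (n - 1 + 1) - w 1 := by
        have : Finset.Icc 1 (n - 1) = Finset.Ico 1 (n - 1 + 1) := by
          ext; simp
        rw [this, Finset.sum_Ico_sub _ (by omega)]
    _ ≤ 2 * M := by
        have h1 := abs_le.1 (hM (n - 1 + 1))
        have h2 := abs_le.1 (hM 1)
        linarith

/-- The mean product of two scores of the coordinatewise ranks of a bivariate sample. -/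
noncomputable def rankProduct (w : ℕ → ℝ) (z : Fin n → ℝ × ℝ) : ℝ :=
  (∑ i, w (tieRank (fun l => (z l).1) i) * w (tieRank (fun l => (z l).2) i)) / n

lemma measurable_comp_tieRank (w : ℕ → ℝ) (i : Fin n) :
    Measurable fun v : Fin n → ℝ => w (tieRank v i) := by
  have h : ∀ v : Fin n → ℝ, tieRank v i =
      ∑ l, if v l < v i ∨ (v l = v i ∧ l ≤ i) then 1 else 0 := fun v => by
    simp only [tieRank, Finset.card_filter, Prod.Lex.toLex_le_toLex]
  have hm : Measurable fun v : Fin n → ℝ => tieRank v i := by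
    simp_rw [h]
    refine Finset.measurable_sum _ fun l _ => Measurable.ite ?_ measurable_const measurable_const
    have h1 : Measurable fun v : Fin n → ℝ => v l := measurable_pi_apply l
    have h2 : Measurable fun v : Fin n → ℝ => v i := measurable_pi_apply i
    exact (measurableSet_lt h1 h2).union
      ((measurableSet_eq_fun h1 h2).inter (MeasurableSet.const _))
  exact (measurable_from_nat (f := w)).comp hm

lemma measurable_rankProduct (w : ℕ → ℝ) : Measurable (rankProduct (n := n) w) := by
  unfold rankProduct
  refine (Finset.measurable_sum _ fun i _ => ?_).div_const _
  have h1 : Measurable fun (z : Fin n → ℝ × ℝ) l => (z l).1 := by fun_prop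
  have h2 : Measurable fun (z : Fin n → ℝ × ℝ) l => (z l).2 := by fun_prop
  exact ((measurable_comp_tieRank w i).comp h1).mul ((measurable_comp_tieRank w i).comp h2)

lemma abs_rankProduct_le {w : ℕ → ℝ} {M : ℝ} (hM : ∀ r, |w r| ≤ M) (z : Fin n → ℝ × ℝ) :
    |rankProduct w z| ≤ M ^ 2 := by
  have hM0 : 0 ≤ M := (abs_nonneg _).trans (hM 0)
  rcases Nat.eq_zero_or_pos n with rfl | hn
  · simp [rankProduct]; positivity
  have hn' : (0 : ℝ) < n := by exact_mod_cast hn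
  rw [rankProduct, abs_div, abs_of_pos hn', div_le_iff₀ hn']
  calc _ ≤ ∑ i, |w (tieRank (fun l => (z l).1) i) * w (tieRank (fun l => (z l).2) i)| :=
        Finset.abs_sum_le_sum_abs _ _
    _ ≤ ∑ _i : Fin n, M ^ 2 := by
        refine Finset.sum_le_sum fun i _ => ?_
        rw [abs_mul, sq]
        exact mul_le_mul (hM _) (hM _) (abs_nonneg _) hM0
    _ = M ^ 2 * n := by simp [mul_comm]

/-- The replaced observation itself contributes at most `2M²`. For the others, split the change of
the product into a change in each factor; each coordinate contributes at most `M · 2M`. -/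
lemma abs_rankProduct_update_sub_le {w : ℕ → ℝ} (hw : Monotone w) {M : ℝ}
    (hM : ∀ r, |w r| ≤ M) (z : Fin n → ℝ × ℝ) (m : Fin n) (y : ℝ × ℝ) :
    |rankProduct w (Function.update z m y) - rankProduct w z| ≤ 6 * M ^ 2 / n := by
  have hM0 : 0 ≤ M := (abs_nonneg _).trans (hM 0)
  have hn' : (0 : ℝ) < n := by exact_mod_cast m.pos
  have e1 : (fun l => (Function.update z m y l).1) = Function.update (fun l => (z l).1) m y.1 := by
    ext l; by_cases h : l = m
    · subst h; simp
    · simp [h]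
  have e2 : (fun l => (Function.update z m y l).2) = Function.update (fun l => (z l).2) m y.2 := by
    ext l; by_cases h : l = m
    · subst h; simp
    · simp [h]
  rw [rankProduct, rankProduct, e1, e2, ← sub_div, abs_div, abs_of_pos hn']
  gcongr
  rw [← Finset.sum_sub_distrib]
  set a := fun i => w (tieRank (fun l => (z l).1) i)
  set b := fun i => w (tieRank (fun l => (z l).2) i)
  set a' := fun i => w (tieRank (Function.update (fun l => (z l).1) m y.1) i)
  set b' := fun i => w (tieRank (Function.update (fun l => (z l).2) m y.2) i)
  have ha : ∑ i ∈ Finset.univ.erase m, |a' i - a i| ≤ 2 * M :=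
    sum_erase_abs_tieRank_update_sub_le hw hM m _ _
  have hb : ∑ i ∈ Finset.univ.erase m, |b' i - b i| ≤ 2 * M :=
    sum_erase_abs_tieRank_update_sub_le hw hM m _ _
  calc |∑ i, (a' i * b' i - a i * b i)| ≤ ∑ i, |a' i * b' i - a i * b i| :=
        Finset.abs_sum_le_sum_abs _ _
    _ = |a' m * b' m - a m * b m| + ∑ i ∈ Finset.univ.erase m, |a' i * b' i - a i * b i| :=
        (Finset.add_sum_erase _ _ (Finset.mem_univ m)).symm
    _ ≤ 2 * M ^ 2 + ∑ i ∈ Finset.univ.erase m, (M * |a' i - a i| + M * |b' i - b i|) := by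
        refine add_le_add ?_ (Finset.sum_le_sum fun i _ => ?_)
        · calc _ ≤ |a' m * b' m| + |a m * b m| := abs_sub _ _
            _ ≤ M * M + M * M := by
              rw [abs_mul, abs_mul]
              exact add_le_add (mul_le_mul (hM _) (hM _) (abs_nonneg _) hM0)
                (mul_le_mul (hM _) (hM _) (abs_nonneg _) hM0)
            _ = 2 * M ^ 2 := by ring
        · have e : a' i * b' i - a i * b i = b' i * (a' i - a i) + a i * (b' i - b i) := by ring
          rw [e]
          refine (abs_add_le _ _).trans ?_
          rw [abs_mul, abs_mul]
          exact add_le_add (mul_le_mul_of_nonneg_right (hM _) (abs_nonneg _))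
            (mul_le_mul_of_nonneg_right (hM _) (abs_nonneg _))
    _ = 2 * M ^ 2 + (M * ∑ i ∈ Finset.univ.erase m, |a' i - a i| +
          M * ∑ i ∈ Finset.univ.erase m, |b' i - b i|) := by
        rw [Finset.sum_add_distrib, Finset.mul_sum, Finset.mul_sum]
    _ ≤ 2 * M ^ 2 + (M * (2 * M) + M * (2 * M)) := by gcongr
    _ = 6 * M ^ 2 := by ring

/-! ### Normal scores -/

/-- The Winsorized normal score of rank `r` in a sample of size `n`. -/
noncomputable def normalScore (n r : ℕ) : ℝ :=
  stdNormalQuantile (winsorize (1 / (n : ℝ) ^ 2) (1 - 1 / (n : ℝ) ^ 2) (r / n))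

/-- The largest Winsorized normal score in a sample of size `n`. -/
noncomputable def maxScore (n : ℕ) : ℝ := stdNormalQuantile (1 - 1 / (n : ℝ) ^ 2)

lemma winsorize_mem_Icc {a b : ℝ} (hab : a ≤ b) (u : ℝ) : winsorize a b u ∈ Icc a b := by
  unfold winsorize
  split_ifs <;> constructor <;> linarith

lemma winsorize_mono {a b : ℝ} (hab : a ≤ b) : Monotone (winsorize a b) := by
  intro u v huv
  unfold winsorize
  split_ifs <;> linarith

lemma winsorize_eq_self {a b u : ℝ} (hu : u ∈ Icc a b) : winsorize a b u = u := by
  unfold winsorize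
  rw [if_neg (not_lt.2 hu.2), if_neg (not_lt.2 hu.1)]

lemma abs_winsorize_sub_le {a b t : ℝ} (ht : t ∈ Icc a b) (u : ℝ) :
    |winsorize a b u - t| ≤ |u - t| := by
  obtain ⟨h1, h2⟩ := ht
  unfold winsorize
  split_ifs
  · rw [abs_of_nonneg (by linarith), abs_of_nonneg (by linarith)]; linarith
  · rw [abs_of_nonpos (by linarith), abs_of_nonpos (by linarith)]; linarith
  · exact le_rfl

section Score

lemma inv_sq_pos_and_le (hn : 2 ≤ n) : 0 < 1 / (n : ℝ) ^ 2 ∧ 1 / (n : ℝ) ^ 2 ≤ 1 / 4 := by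
  have h2 : (2 : ℝ) ≤ n := by exact_mod_cast hn
  refine ⟨by positivity, ?_⟩
  apply one_div_le_one_div_of_le (by norm_num)
  nlinarith

lemma winsorize_score_mem (hn : 2 ≤ n) (u : ℝ) :
    0 < winsorize (1 / (n : ℝ) ^ 2) (1 - 1 / (n : ℝ) ^ 2) u ∧
      winsorize (1 / (n : ℝ) ^ 2) (1 - 1 / (n : ℝ) ^ 2) u < 1 := by
  obtain ⟨h0, h1⟩ := inv_sq_pos_and_le hn
  obtain ⟨h2, h3⟩ := winsorize_mem_Icc (a := 1 / (n : ℝ) ^ 2) (b := 1 - 1 / (n : ℝ) ^ 2)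
    (by linarith) u
  constructor <;> linarith

lemma stdNormalCDF_maxScore (hn : 2 ≤ n) : stdNormalCDF (maxScore n) = 1 - 1 / (n : ℝ) ^ 2 := by
  obtain ⟨h0, h1⟩ := inv_sq_pos_and_le hn
  exact stdNormalCDF_stdNormalQuantile (by linarith) (by linarith)

lemma stdNormalQuantile_inv_sq (hn : 2 ≤ n) :
    stdNormalQuantile (1 / (n : ℝ) ^ 2) = -maxScore n := by
  obtain ⟨h0, h1⟩ := inv_sq_pos_and_le hn
  rw [maxScore, stdNormalQuantile_one_sub (by linarith) (by linarith), neg_neg]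

lemma maxScore_nonneg (hn : 2 ≤ n) : 0 ≤ maxScore n := by
  obtain ⟨h0, h1⟩ := inv_sq_pos_and_le hn
  have := stdNormalQuantile_mono (u := 1 / (n : ℝ) ^ 2) (v := 1 - 1 / (n : ℝ) ^ 2)
    (by linarith) (by linarith) (by linarith)
  rw [stdNormalQuantile_inv_sq hn] at this
  change _ ≤ maxScore n at this
  linarith

/-- The tail bound at the top score reads `1 / n² ≤ exp (-M² / 2)`. -/
lemma maxScore_sq_le (hn : 2 ≤ n) : maxScore n ^ 2 ≤ 4 * Real.log n := by
  have hn0 : (0 : ℝ) < n := by positivity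
  have h := one_sub_stdNormalCDF_le (maxScore_nonneg hn)
  rw [stdNormalCDF_maxScore hn, sub_sub_cancel] at h
  have h2 := Real.log_le_log (by positivity) h
  rw [Real.log_exp, one_div, Real.log_inv, Real.log_pow] at h2
  push_cast at h2
  linarith

lemma abs_normalScore_le (hn : 2 ≤ n) (r : ℕ) : |normalScore n r| ≤ maxScore n := by
  obtain ⟨h0, h1⟩ := inv_sq_pos_and_le hn
  obtain ⟨h2, h3⟩ := winsorize_mem_Icc (a := 1 / (n : ℝ) ^ 2) (b := 1 - 1 / (n : ℝ) ^ 2)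
    (by linarith) ((r : ℝ) / n)
  rw [abs_le]
  constructor
  · rw [← stdNormalQuantile_inv_sq hn]
    exact stdNormalQuantile_mono h0 h2 (by linarith)
  · exact stdNormalQuantile_mono (by linarith) h3 (by linarith)

lemma monotone_normalScore (hn : 2 ≤ n) : Monotone (normalScore n) := by
  obtain ⟨h0, h1⟩ := inv_sq_pos_and_le hn
  intro r s hrs
  refine stdNormalQuantile_mono (winsorize_score_mem hn _).1 ?_ (winsorize_score_mem hn _).2
  apply winsorize_mono (by linarith)
  gcongr

lemma normalScore_self (hn : 2 ≤ n) : normalScore n n = maxScore n := by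
  obtain ⟨h0, h1⟩ := inv_sq_pos_and_le hn
  have hn0 : (n : ℝ) ≠ 0 := by positivity
  rw [normalScore, div_self hn0, winsorize, if_pos (by linarith), maxScore]

/-- Since `1 / n² ≤ 1 / n`, Winsorization alters none of the attainable ranks except `n`. -/
lemma normalScore_eq {r : ℕ} (h1 : 1 ≤ r) (h2 : r < n) :
    normalScore n r = stdNormalQuantile (r / n) := by
  have hn0 : (0 : ℝ) < n := by exact_mod_cast (show 0 < n by omega)
  have hn1 : (1 : ℝ) ≤ n := by exact_mod_cast (show 1 ≤ n by omega)
  have h1' : (1 : ℝ) ≤ r := by exact_mod_cast h1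
  have h2' : (r : ℝ) + 1 ≤ n := by exact_mod_cast h2
  have h3 : 1 / (n : ℝ) ^ 2 ≤ 1 / n := by
    apply one_div_le_one_div_of_le hn0
    nlinarith
  rw [normalScore, winsorize_eq_self]
  constructor
  · exact h3.trans (by gcongr)
  · have : (r : ℝ) / n ≤ 1 - 1 / n := by
      rw [le_sub_iff_add_le, ← add_div, div_le_one hn0]; exact h2'
    linarith

/-- By symmetry of the Gaussian, the scores of `r` and `n - r` are opposite; only rank `n` has no
partner. -/
lemma sum_normalScore (hn : 2 ≤ n) : ∑ r ∈ Finset.Icc 1 n, normalScore n r = maxScore n := by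
  have hn0 : (0 : ℝ) < n := by positivity
  have e : Finset.Icc 1 n = insert n (Finset.Ico 1 n) := by
    ext r; simp only [Finset.mem_Icc, Finset.mem_insert, Finset.mem_Ico]; omega
  rw [e, Finset.sum_insert (by simp), normalScore_self hn]
  have h : ∑ r ∈ Finset.Ico 1 n, normalScore n r = ∑ r ∈ Finset.Ico 1 n, -normalScore n r := by
    refine Finset.sum_bij' (fun r _ => n - r) (fun r _ => n - r) ?_ ?_ ?_ ?_ ?_
    · intro r hr; rw [Finset.mem_Ico] at hr ⊢; omega
    · intro r hr; rw [Finset.mem_Ico] at hr ⊢; omega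
    · intro r hr; rw [Finset.mem_Ico] at hr; omega
    · intro r hr; rw [Finset.mem_Ico] at hr; omega
    · intro r hr
      rw [Finset.mem_Ico] at hr
      rw [normalScore_eq hr.1 hr.2, normalScore_eq (by omega) (by omega), Nat.cast_sub hr.2.le,
        sub_div, div_self hn0.ne', stdNormalQuantile_one_sub, neg_neg]
      · have : (0 : ℝ) < r := by exact_mod_cast hr.1
        positivity
      · rw [div_lt_one hn0]; exact_mod_cast hr.2
  rw [Finset.sum_neg_distrib] at h
  linarith

end Score

/-! ### Normal scores of the ranks approximate a Gaussian sample -/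

/-- The mean square error of `(1 + #{l | y l ≤ t}) / (m + 1)` as an estimator of `Φ(t)`. -/
lemma integral_sq_empirical_sub_le (m : ℕ) (t : ℝ)
    (hu : 1 / ((m : ℝ) + 1) ≤ stdNormalCDF t) :
    ∫ y : Fin m → ℝ, ((1 + ((Finset.univ.filter fun l => y l ≤ t).card : ℝ)) / (m + 1)
        - stdNormalCDF t) ^ 2 ∂(Measure.pi fun _ => gaussianReal 0 1) ≤
      2 * (stdNormalCDF t * (1 - stdNormalCDF t)) / (m + 1) := by
  set u := stdNormalCDF t
  have hu0 : 0 < u := stdNormalCDF_pos t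
  have hu1 : u < 1 := stdNormalCDF_lt_one t
  set g : ℝ → ℝ := (Iic t).indicator 1
  have hgm : Measurable g := measurable_one.indicator measurableSet_Iic
  have hgb : ∀ x, |g x| ≤ 1 := fun x => by
    by_cases hx : x ∈ Iic t <;> simp [g, hx]
  have hgi : ∫ x, g x ∂(gaussianReal 0 1) = u := by
    rw [integral_indicator_one measurableSet_Iic, ← stdNormalCDF_eq_real]
  have hgL : MemLp g 2 (gaussianReal 0 1) :=
    MemLp.of_bound hgm.aestronglyMeasurable 1 (ae_of_all _ hgb)
  have hgv : Var[g; gaussianReal 0 1] ≤ (1 - u) * u := by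
    have := variance_le_sub_mul_sub (μ := gaussianReal 0 1) (X := g) (a := 0) (b := 1)
      (ae_of_all _ fun x => by by_cases hx : x ∈ Iic t <;> simp [g, hx]) hgm.aemeasurable
    rwa [hgi, sub_zero] at this
  set Γ : Measure (Fin m → ℝ) := Measure.pi fun _ => gaussianReal 0 1
  set N : (Fin m → ℝ) → ℝ := ∑ l, fun y => g (y l) with hN
  have hNe : ∀ y, ((Finset.univ.filter fun l => y l ≤ t).card : ℝ) = N y := fun y => by
    rw [hN, Finset.sum_apply, Finset.card_filter]
    push_cast
    refine Finset.sum_congr rfl fun l _ => ?_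
    by_cases hx : y l ≤ t <;> simp [g, hx]
  have hgl : ∀ l : Fin m, MemLp (fun y : Fin m → ℝ => g (y l)) 2 Γ := fun l =>
    hgL.comp_measurePreserving (measurePreserving_eval _ l)
  have hNL : MemLp N 2 Γ := memLp_finsetSum' _ fun l _ => hgl l
  have hNv : Var[N; Γ] ≤ m * ((1 - u) * u) := by
    have := variance_sum_pi (μ := fun _ : Fin m => gaussianReal 0 1) (X := fun _ => g)
      fun _ => hgL
    rw [hN, this]
    simpa using mul_le_mul_of_nonneg_left hgv (Nat.cast_nonneg m)
  have hNm : ∫ y, N y ∂Γ = m * u := by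
    simp_rw [hN, Finset.sum_apply]
    rw [integral_finsetSum _ fun l _ => (hgl l).integrable (by norm_num)]
    have : ∀ l : Fin m, ∫ y, g (y l) ∂Γ = u := fun l => by
      rw [← hgi]
      exact integral_comp_eval (μ := fun _ : Fin m => gaussianReal 0 1)
        hgm.aestronglyMeasurable
    simp [this]
  have hNi : Integrable N Γ := hNL.integrable (by norm_num)
  have hm : (0 : ℝ) < m + 1 := by positivity
  have hsq : ∫ y, (N y - m * u) ^ 2 ∂Γ ≤ m * ((1 - u) * u) := by
    rw [variance_eq_integral hNL.aemeasurable, hNm] at hNv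
    exact hNv
  have hsqi : Integrable (fun y => (N y - m * u) ^ 2) Γ :=
    (hNL.sub (memLp_const _)).integrable_sq
  have hlin : ∫ y, (N y - m * u) ∂Γ = 0 := by
    rw [integral_sub hNi (integrable_const _), hNm]; simp
  -- The extra 1 in the numerator, which counts the observation at `t` itself, creates a bias of `(1
  -- - u) / (m + 1)`.
  have e : ∀ y : Fin m → ℝ, ((1 + ((Finset.univ.filter fun l => y l ≤ t).card : ℝ)) / (m + 1)
      - u) ^ 2 = ((N y - m * u) ^ 2 + 2 * (1 - u) * (N y - m * u) + (1 - u) ^ 2) /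
        (m + 1) ^ 2 := fun y => by
    rw [hNe]; field_simp; ring
  simp_rw [e]
  have hli : Integrable (fun y => 2 * (1 - u) * (N y - m * u)) Γ :=
    (hNi.sub (integrable_const _)).const_mul _
  rw [integral_div, integral_add (f := fun y => (N y - m * u) ^ 2 + 2 * (1 - u) * (N y - m * u))
    (hsqi.add hli) (integrable_const _), integral_add hsqi hli, integral_const_mul, hlin]
  rw [div_le_div_iff₀ (by positivity) hm]
  simp only [integral_const, probReal_univ, smul_eq_mul, one_mul, mul_zero, add_zero]
  rw [div_le_iff₀ hm] at hu
  -- The assumption `1 / (m + 1) ≤ u` lets a variance-sized term absorb the squared bias.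
  have h3 : (1 - u) ^ 2 ≤ (1 - u) * (u * (m + 1)) := by nlinarith
  have h4 : ∫ y, (N y - m * u) ^ 2 ∂Γ + (1 - u) ^ 2 ≤ 2 * (u * (1 - u)) * (m + 1) := by
    have : 0 ≤ (1 - u) * u := by nlinarith
    nlinarith
  nlinarith

/-- Two coordinates have a product law, and the diagonal is null by Fubini because the Gaussian has
no atoms. -/
lemma ae_injective_pi {n : ℕ} :
    ∀ᵐ z ∂(Measure.pi fun _ : Fin n => gaussianReal 0 1), Function.Injective z := by
  have h : ∀ a b : Fin n, a ≠ b →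
      ∀ᵐ z ∂(Measure.pi fun _ : Fin n => gaussianReal 0 1), z a ≠ z b := by
    intro a b hab
    have hind := (iIndepFun_pi (μ := fun _ : Fin n => gaussianReal 0 1)
      (X := fun _ => id) fun _ => aemeasurable_id).indepFun hab
    have hmap := (indepFun_iff_map_prod_eq_prod_map_map
      (measurable_pi_apply a).aemeasurable (measurable_pi_apply b).aemeasurable).1 hind
    have ha : (Measure.pi fun _ : Fin n => gaussianReal 0 1).map (fun z => z a) =
        gaussianReal 0 1 := (measurePreserving_eval _ a).map_eq
    have hb : (Measure.pi fun _ : Fin n => gaussianReal 0 1).map (fun z => z b) =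
        gaussianReal 0 1 := (measurePreserving_eval _ b).map_eq
    have hD : MeasurableSet {q : ℝ × ℝ | q.1 = q.2} := measurableSet_eq_fun measurable_fst
      measurable_snd
    have h0 : ((gaussianReal 0 1).prod (gaussianReal 0 1)) {q : ℝ × ℝ | q.1 = q.2} = 0 := by
      rw [Measure.measure_prod_null hD]
      refine ae_of_all _ fun x => ?_
      have : Prod.mk x ⁻¹' {q : ℝ × ℝ | q.1 = q.2} = {x} := by
        ext y; simp [eq_comm]
      change (gaussianReal 0 1) (Prod.mk x ⁻¹' {q : ℝ × ℝ | q.1 = q.2}) = 0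
      rw [this]
      exact measure_singleton x
    rw [ae_iff]
    simp only [not_not]
    have h1 : (Measure.pi fun _ : Fin n => gaussianReal 0 1) {z | z a = z b} =
        ((Measure.pi fun _ : Fin n => gaussianReal 0 1).map fun z => (z a, z b))
          {q : ℝ × ℝ | q.1 = q.2} := by
      rw [Measure.map_apply ((measurable_pi_apply a).prodMk (measurable_pi_apply b)) hD]
      rfl
    rw [h1, hmap]
    rw [ha, hb, h0]
  have h2 : ∀ᵐ z ∂(Measure.pi fun _ : Fin n => gaussianReal 0 1),
      ∀ a b : Fin n, a ≠ b → z a ≠ z b := by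
    rw [ae_all_iff]; intro a
    rw [ae_all_iff]; intro b
    by_cases hab : a = b
    · exact ae_of_all _ fun z h => absurd hab h
    · exact (h a b hab).mono fun z hz _ => hz
  filter_upwards [h2] with z hz a b hab
  by_contra hne
  exact hz a b hne hab

/-! ### Gaussian integrals needed for the mean-square error -/

/-- Against the Gaussian density the integrand is the derivative of the log-odds `log (Φ / (1 -
Φ))`, which is odd. -/
lemma integral_inv_stdNormalCDF_mul_one_sub {T : ℝ} (hT : 0 ≤ T) :
    ∫ t in Icc (-T) T, 1 / (stdNormalCDF t * (1 - stdNormalCDF t)) ∂(gaussianReal 0 1) =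
      2 * Real.log (stdNormalCDF T / (1 - stdNormalCDF T)) := by
  have h0 := stdNormalCDF_pos
  have h1 : ∀ t, 0 < 1 - stdNormalCDF t := fun t => sub_pos.2 (stdNormalCDF_lt_one t)
  rw [gaussianReal_of_var_ne_zero 0 one_ne_zero,
    setIntegral_withDensity_eq_setIntegral_toReal_smul (measurable_gaussianPDF 0 1)
      (ae_of_all _ fun _ => gaussianPDF_lt_top) _ measurableSet_Icc,
    integral_Icc_eq_integral_Ioc, ← intervalIntegral.integral_of_le (by linarith)]
  have hder : ∀ t ∈ uIcc (-T) T, HasDerivAt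
      (fun t => Real.log (stdNormalCDF t) - Real.log (1 - stdNormalCDF t))
      ((gaussianPDF 0 1 t).toReal • (1 / (stdNormalCDF t * (1 - stdNormalCDF t)))) t := by
    intro t _
    have hd := hasDerivAt_stdNormalCDF t
    convert! (hd.log (h0 t).ne').sub ((hd.const_sub 1).log (h1 t).ne') using 1
    rw [toReal_gaussianPDF, smul_eq_mul]
    have := (h0 t).ne'
    have := (h1 t).ne'
    field_simp
    ring
  rw [intervalIntegral.integral_eq_sub_of_hasDerivAt hder]
  · rw [stdNormalCDF_neg, sub_sub_cancel, Real.log_div (h0 T).ne' (h1 T).ne']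
    ring
  · apply Continuous.intervalIntegrable
    simp_rw [toReal_gaussianPDF, smul_eq_mul]
    exact continuous_stdGaussianPDF.mul (continuous_const.div
      (continuous_stdNormalCDF.mul (continuous_const.sub continuous_stdNormalCDF))
      fun t => (mul_pos (h0 t) (h1 t)).ne')

lemma integrableOn_inv_stdNormalCDF_mul_one_sub (T : ℝ) :
    IntegrableOn (fun t => 1 / (stdNormalCDF t * (1 - stdNormalCDF t))) (Icc (-T) T)
      (gaussianReal 0 1) :=
  (continuous_const.div
      (continuous_stdNormalCDF.mul (continuous_const.sub continuous_stdNormalCDF))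
      fun t => (mul_pos (stdNormalCDF_pos t)
        (sub_pos.2 (stdNormalCDF_lt_one t))).ne').continuousOn.integrableOn_Icc

lemma measureReal_compl_Icc_le (T : ℝ) :
    (gaussianReal 0 1).real (Icc (-T) T)ᶜ ≤ 2 * (1 - stdNormalCDF T) := by
  calc _ ≤ (gaussianReal 0 1).real (Iic (-T) ∪ Ioi T) := measureReal_mono fun x hx => by
        by_contra h
        simp only [mem_union, mem_Iic, mem_Ioi, not_or, not_le, not_lt] at h
        exact hx ⟨h.1.le, h.2⟩
    _ ≤ _ := measureReal_union_le _ _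
    _ = _ := by
        rw [← stdNormalCDF_eq_real, ← one_sub_stdNormalCDF_eq_real, stdNormalCDF_neg]; ring

lemma integrable_pow_four_stdGaussian : Integrable (fun t : ℝ => t ^ 4) (gaussianReal 0 1) := by
  have := (memLp_id_gaussianReal' (μ := 0) (v := 1) 4 (by norm_num)).integrable_norm_pow
    (p := 4) (by norm_num)
  refine this.congr (ae_of_all _ fun t => ?_)
  simp only [id, Real.norm_eq_abs]
  exact Even.pow_abs (by decide) t

lemma integrable_sq_stdGaussian : Integrable (fun t : ℝ => t ^ 2) (gaussianReal 0 1) :=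
  (memLp_id_gaussianReal' (μ := 0) (v := 1) 2 (by norm_num)).integrable_sq

/-- A crude constant suffices: `t⁴ ≤ 24 (e^t + e^(-t))`, integrated with the moment generating
function. -/
lemma integral_pow_four_stdGaussian_le : ∫ t, t ^ 4 ∂(gaussianReal 0 1) ≤ 96 := by
  have hp : ∀ s, Integrable (fun t : ℝ => Real.exp (s * t)) (gaussianReal 0 1) :=
    integrable_exp_mul_gaussianReal
  have hmgf : ∀ s, ∫ t, Real.exp (s * t) ∂(gaussianReal 0 1) = Real.exp (s ^ 2 / 2) := fun s => by
    have := congrFun (mgf_id_gaussianReal (μ := 0) (v := 1)) s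
    simpa [mgf] using this
  calc ∫ t, t ^ 4 ∂(gaussianReal 0 1)
      ≤ ∫ t, 24 * (Real.exp (1 * t) + Real.exp (-1 * t)) ∂(gaussianReal 0 1) := by
        refine integral_mono integrable_pow_four_stdGaussian
          (((hp 1).add (hp (-1))).const_mul 24) fun t => ?_
        have h := Real.pow_div_factorial_le_exp |t| (abs_nonneg t) 4
        rw [Even.pow_abs (by decide) t, show ((Nat.factorial 4 : ℕ) : ℝ) = 24 by norm_num
          [Nat.factorial]] at h
        have h1 := Real.exp_pos (1 * t)
        have h2 := Real.exp_pos (-1 * t)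
        have h3 : Real.exp |t| ≤ Real.exp (1 * t) + Real.exp (-1 * t) := by
          rcases abs_cases t with ⟨h, _⟩ | ⟨h, _⟩
          · rw [h, one_mul] at *; linarith
          · rw [h, neg_one_mul] at *; linarith
        change t ^ 4 ≤ 24 * (Real.exp (1 * t) + Real.exp (-1 * t))
        linarith
    _ = 48 * Real.exp (1 / 2) := by
        rw [integral_const_mul, integral_add (hp 1) (hp (-1)), hmgf, hmgf]
        norm_num; ring
    _ ≤ 96 := by
        have h1 : Real.exp (1 / 2) ^ 2 = Real.exp 1 := by
          rw [← Real.exp_nat_mul]; norm_num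
        have h2 := Real.exp_one_lt_three
        have h3 := Real.exp_pos (1 / 2)
        nlinarith

/-- Winsorization projects onto an interval containing `Φ(t)`, so it does not increase the distance
to `Φ(t)`; the two-point estimate on `[-M, M]` then transfers this distance to the quantile scale.
-/
lemma sq_normalScore_sub_le {n : ℕ} (hn : 2 ≤ n) (r : ℕ) {t : ℝ} (ht : |t| ≤ maxScore n) :
    (normalScore n r - t) ^ 2 ≤ (18 * (1 + maxScore n) ^ 2) ^ 2 *
      ((r : ℝ) / n - stdNormalCDF t) ^ 2 / (stdNormalCDF t * (1 - stdNormalCDF t)) ^ 2 := by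
  have h0 : 0 < stdNormalCDF t * (1 - stdNormalCDF t) :=
    mul_pos (stdNormalCDF_pos t) (sub_pos.2 (stdNormalCDF_lt_one t))
  have h1 := abs_sub_mul_le_abs_stdNormalCDF_sub (abs_normalScore_le hn r) ht
  obtain ⟨h2, h3⟩ := winsorize_score_mem hn ((r : ℝ) / n)
  have h4 : stdNormalCDF (normalScore n r) =
      winsorize (1 / (n : ℝ) ^ 2) (1 - 1 / (n : ℝ) ^ 2) (r / n) :=
    stdNormalCDF_stdNormalQuantile h2 h3
  have hm := stdNormalCDF_maxScore hn
  have h5 : stdNormalCDF t ∈ Icc (1 / (n : ℝ) ^ 2) (1 - 1 / (n : ℝ) ^ 2) := by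
    rw [abs_le] at ht
    constructor
    · have := strictMono_stdNormalCDF.monotone ht.1
      rw [stdNormalCDF_neg, hm] at this
      linarith
    · have := strictMono_stdNormalCDF.monotone ht.2
      rwa [hm] at this
  have h6 := abs_winsorize_sub_le h5 ((r : ℝ) / n)
  rw [← h4] at h6
  rw [le_div_iff₀ (by positivity), ← mul_pow, ← mul_pow, sq_le_sq]
  rw [abs_mul, abs_of_pos h0, abs_mul, abs_of_nonneg (a := 18 * _) (by positivity)]
  exact h1.trans (by gcongr)

lemma card_insertNth_le {m : ℕ} (i : Fin (m + 1)) (t : ℝ) (y : Fin m → ℝ) :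
    (Finset.univ.filter fun l => (i.insertNth t y : Fin (m + 1) → ℝ) l ≤ t).card =
      1 + (Finset.univ.filter fun l => y l ≤ t).card := by
  rw [Finset.card_filter, Finset.card_filter, Fin.sum_univ_succAbove _ i]
  simp

/-- Fubini in coordinate `i`: given `z i = t`, the rank is one (for the observation itself) plus a
count over the `m` independent others. -/
lemma integral_pi_comp_card_le {n m : ℕ} (hnm : n = m + 1) (γ : Measure ℝ)
    [IsProbabilityMeasure γ] (i : Fin n) {f : ℕ → ℝ → ℝ}
    (hf : Integrable (fun z : Fin n → ℝ => f (Finset.univ.filter fun l => z l ≤ z i).card (z i))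
      (Measure.pi fun _ => γ)) :
    ∫ z : Fin n → ℝ, f (Finset.univ.filter fun l => z l ≤ z i).card (z i)
        ∂(Measure.pi fun _ => γ) =
      ∫ t, ∫ y : Fin m → ℝ, f (1 + (Finset.univ.filter fun l => y l ≤ t).card) t
        ∂(Measure.pi fun _ => γ) ∂γ := by
  subst hnm
  rw [integral_pi_succ γ i hf]
  simp only [Fin.insertNth_apply_same, card_insertNth_le]

/-- The mean square distance of a standard Gaussian variable to the normal score of its rank. -/
lemma integral_sq_normalScore_tieRank_sub_le {n : ℕ} (hn : 2 ≤ n) (i : Fin n) :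
    Integrable (fun z : Fin n → ℝ => (normalScore n (tieRank z i) - z i) ^ 2)
      (Measure.pi fun _ => gaussianReal 0 1) ∧
    ∫ z : Fin n → ℝ, (normalScore n (tieRank z i) - z i) ^ 2
        ∂(Measure.pi fun _ => gaussianReal 0 1) ≤
      (4 * (18 * (1 + maxScore n) ^ 2) ^ 2 * Real.log n + 8 * maxScore n ^ 2 + 98) / n := by
  obtain ⟨m, hnm⟩ : ∃ m, n = m + 1 := ⟨n - 1, by omega⟩
  have hcast : (n : ℝ) = m + 1 := by rw [hnm]; push_cast; ring
  have hn0 : (0 : ℝ) < n := by rw [hcast]; positivity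
  have hn2 : (2 : ℝ) ≤ n := by exact_mod_cast hn
  set M := maxScore n
  set K := (18 * (1 + M) ^ 2) ^ 2
  set Γ : Measure (Fin n → ℝ) := Measure.pi fun _ => gaussianReal 0 1 with hΓ
  have hM0 : 0 ≤ M := maxScore_nonneg hn
  have hcrude : ∀ (r : ℕ) (t : ℝ), (normalScore n r - t) ^ 2 ≤ 2 * M ^ 2 + 2 * t ^ 2 := by
    intro r t
    have : normalScore n r ^ 2 ≤ M ^ 2 := sq_le_sq' (abs_le.1 (abs_normalScore_le hn r)).1
      (abs_le.1 (abs_normalScore_le hn r)).2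
    nlinarith [sq_nonneg (normalScore n r + t)]
  have hint : Integrable (fun z : Fin n → ℝ => (normalScore n (tieRank z i) - z i) ^ 2) Γ := by
    have hsq : Integrable (fun z : Fin n → ℝ => z i ^ 2) Γ :=
      (measurePreserving_eval (fun _ : Fin n => gaussianReal 0 1) i).integrable_comp_of_integrable
        integrable_sq_stdGaussian
    refine Integrable.mono' ((integrable_const (2 * M ^ 2)).add (hsq.const_mul 2)) ?_ ?_
    · exact (((measurable_comp_tieRank (normalScore n) i).sub
        (measurable_pi_apply i)).pow_const 2).aestronglyMeasurable
    · refine ae_of_all _ fun z => ?_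
      rw [Real.norm_of_nonneg (sq_nonneg _)]
      exact hcrude _ _
  refine ⟨hint, ?_⟩
  have hae : (fun z : Fin n → ℝ => (normalScore n (tieRank z i) - z i) ^ 2) =ᵐ[Γ]
      fun z => (normalScore n (Finset.univ.filter fun l => z l ≤ z i).card - z i) ^ 2 := by
    filter_upwards [ae_injective_pi] with z hz
    rw [tieRank_eq_of_injective hz]
  rw [integral_congr_ae hae, hΓ, integral_pi_comp_card_le hnm (gaussianReal 0 1) i
    (f := fun r t => (normalScore n r - t) ^ 2) (hint.congr hae)]
  have hinv : 1 / (n : ℝ) ≤ 1 / 2 := one_div_le_one_div_of_le (by norm_num) hn2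
  have hinv0 : 0 < 1 / (n : ℝ) := by positivity
  -- On `[-T, T]` one has `Φ(t) ≥ 1 / n`, exactly what the mean-square estimate for the empirical
  -- distribution requires.
  obtain ⟨T, hT⟩ := exists_stdNormalCDF_eq (u := 1 - 1 / (n : ℝ)) (by linarith) (by linarith)
  have hT0 : 0 ≤ T := by
    by_contra h
    have h1 := strictMono_stdNormalCDF (show T < -T by linarith)
    rw [stdNormalCDF_neg, hT] at h1
    linarith
  have hTM : T ≤ M := by
    rw [← strictMono_stdNormalCDF.le_iff_le, hT, stdNormalCDF_maxScore hn]
    have : 1 / (n : ℝ) ^ 2 ≤ 1 / n := one_div_le_one_div_of_le hn0 (by nlinarith)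
    linarith
  set V : ℝ → ℝ := fun t => 1 / (stdNormalCDF t * (1 - stdNormalCDF t))
  -- The envelope treats three zones: the bulk `[-T, T]`, by the mean-square estimate; `T < |t| ≤
  -- M`, by `4M²` on a set of mass at most `2 / n`; and `|t| > M`, where `2t² ≤ t⁴ / n + n` and the
  -- mass is at most `2 / n²`.
  set b : ℝ → ℝ := fun t => 2 * K / n * (Icc (-T) T).indicator V t +
    4 * M ^ 2 * (Icc (-T) T)ᶜ.indicator 1 t + 1 / n * t ^ 4 + n * (Icc (-M) M)ᶜ.indicator 1 t
    with hb
  have hV0 : ∀ t, 0 < V t := fun t => one_div_pos.2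
    (mul_pos (stdNormalCDF_pos t) (sub_pos.2 (stdNormalCDF_lt_one t)))
  have hpt : ∀ t, ∫ y : Fin m → ℝ,
      (normalScore n (1 + (Finset.univ.filter fun l => y l ≤ t).card) - t) ^ 2
        ∂(Measure.pi fun _ => gaussianReal 0 1) ≤ b t := by
    intro t
    have ht4 : 0 ≤ 1 / n * t ^ 4 := by positivity
    have hindM : 0 ≤ n * (Icc (-M) M)ᶜ.indicator (1 : ℝ → ℝ) t :=
      mul_nonneg hn0.le (indicator_nonneg (fun _ _ => zero_le_one) _)
    by_cases ht : t ∈ Icc (-T) T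
    · have hu : 1 / ((m : ℝ) + 1) ≤ stdNormalCDF t := by
        have := strictMono_stdNormalCDF.monotone ht.1
        rw [stdNormalCDF_neg, hT] at this
        rw [← hcast]; linarith
      have hE := integral_sq_empirical_sub_le m t hu
      have htM : |t| ≤ M := (abs_le.2 ht).trans hTM
      have hv := hV0 t
      calc _ ≤ ∫ y : Fin m → ℝ, K * V t ^ 2 *
            ((1 + ((Finset.univ.filter fun l => y l ≤ t).card : ℝ)) / (m + 1)
              - stdNormalCDF t) ^ 2 ∂(Measure.pi fun _ => gaussianReal 0 1) := by
            refine integral_mono_of_nonneg (ae_of_all _ fun y => sq_nonneg _) ?_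
              (ae_of_all _ fun y => ?_)
            · refine Integrable.const_mul ?_ _
              refine integrable_of_abs_le (B := 4) ?_ fun y => ?_
              · have : Measurable fun y : Fin m → ℝ =>
                    ((Finset.univ.filter fun l => y l ≤ t).card : ℝ) := by
                  simp only [Finset.card_filter, Nat.cast_sum]
                  refine Finset.measurable_sum _ fun l _ => ?_
                  exact (Measurable.ite (measurableSet_le (measurable_pi_apply l) measurable_const)
                    measurable_const measurable_const : Measurable fun y : Fin m → ℝ =>
                      if y l ≤ t then 1 else 0) |> (measurable_from_nat (f := Nat.cast)).comp
                fun_prop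
              · have hc : ((Finset.univ.filter fun l => y l ≤ t).card : ℝ) ≤ m := by
                  have := Finset.card_le_univ (Finset.univ.filter fun l => y l ≤ t)
                  rw [Fintype.card_fin] at this
                  exact_mod_cast this
                have hq0 : 0 ≤ (1 + ((Finset.univ.filter fun l => y l ≤ t).card : ℝ)) / (m + 1) := by
                  positivity
                have hq1 : (1 + ((Finset.univ.filter fun l => y l ≤ t).card : ℝ)) / (m + 1) ≤ 1 := by
                  rw [div_le_one (by positivity)]; linarith
                have h0 := stdNormalCDF_pos t
                have h1 := stdNormalCDF_lt_one t
                rw [abs_of_nonneg (sq_nonneg _)]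
                nlinarith
            · have := sq_normalScore_sub_le hn
                (1 + (Finset.univ.filter fun l => y l ≤ t).card) htM
              refine this.trans (le_of_eq ?_)
              rw [hcast]
              push_cast
              simp only [V, K, M]
              field_simp
        _ = K * V t ^ 2 * ∫ y : Fin m → ℝ,
            ((1 + ((Finset.univ.filter fun l => y l ≤ t).card : ℝ)) / (m + 1)
              - stdNormalCDF t) ^ 2 ∂(Measure.pi fun _ => gaussianReal 0 1) :=
            integral_const_mul _ _
        _ ≤ K * V t ^ 2 * (2 * (stdNormalCDF t * (1 - stdNormalCDF t)) / (m + 1)) := by gcongr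
        _ = 2 * K / n * V t := by
            have h0 := (stdNormalCDF_pos t).ne'
            have h1 := (sub_pos.2 (stdNormalCDF_lt_one t)).ne'
            rw [hcast]
            simp only [V]
            field_simp
        _ ≤ b t := by
            simp only [hb]
            rw [indicator_of_mem ht, indicator_of_notMem (notMem_compl_iff.2 ht)]
            linarith
    · calc _ ≤ ∫ y : Fin m → ℝ, (2 * M ^ 2 + 2 * t ^ 2)
            ∂(Measure.pi fun _ => gaussianReal 0 1) :=
            integral_mono_of_nonneg (ae_of_all _ fun y => sq_nonneg _) (integrable_const _)
              (ae_of_all _ fun y => hcrude _ _)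
        _ = 2 * M ^ 2 + 2 * t ^ 2 := by simp
        _ ≤ 4 * M ^ 2 + 1 / n * t ^ 4 + n * (Icc (-M) M)ᶜ.indicator 1 t := by
            by_cases htM : t ∈ Icc (-M) M
            · have : t ^ 2 ≤ M ^ 2 := sq_le_sq' htM.1 htM.2
              linarith
            · rw [indicator_of_mem (mem_compl htM), Pi.one_apply]
              have h : 1 / (n : ℝ) * t ^ 4 + n * 1 - 2 * t ^ 2 = 1 / n * (t ^ 2 - n) ^ 2 := by
                field_simp; ring
              have : 0 ≤ 1 / (n : ℝ) * (t ^ 2 - n) ^ 2 := by positivity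
              nlinarith [sq_nonneg M]
        _ = b t := by
            simp only [hb]
            rw [indicator_of_notMem ht, indicator_of_mem (mem_compl ht)]
            simp
  have hi1 : Integrable ((Icc (-T) T).indicator V) (gaussianReal 0 1) :=
    (integrable_indicator_iff measurableSet_Icc).2 (integrableOn_inv_stdNormalCDF_mul_one_sub T)
  have hi2 : ∀ T : ℝ, Integrable ((Icc (-T) T)ᶜ.indicator (1 : ℝ → ℝ)) (gaussianReal 0 1) :=
    fun T => (integrable_const (1 : ℝ)).indicator measurableSet_Icc.compl
  have hi3 := integrable_pow_four_stdGaussian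
  have hbi : Integrable b (gaussianReal 0 1) :=
    (((hi1.const_mul _).add ((hi2 T).const_mul _)).add (hi3.const_mul _)).add ((hi2 M).const_mul _)
  have hbint : ∫ t, b t ∂(gaussianReal 0 1) =
      2 * K / n * (2 * Real.log (stdNormalCDF T / (1 - stdNormalCDF T))) +
      4 * M ^ 2 * (gaussianReal 0 1).real (Icc (-T) T)ᶜ + 1 / n * ∫ t, t ^ 4 ∂(gaussianReal 0 1) +
      n * (gaussianReal 0 1).real (Icc (-M) M)ᶜ := by
    have j1 : Integrable (fun t => 2 * K / n * (Icc (-T) T).indicator V t) (gaussianReal 0 1) :=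
      hi1.const_mul _
    have j2 : Integrable (fun t => 4 * M ^ 2 * (Icc (-T) T)ᶜ.indicator (1 : ℝ → ℝ) t)
      (gaussianReal 0 1) := (hi2 T).const_mul _
    have j3 : Integrable (fun t : ℝ => 1 / (n : ℝ) * t ^ 4) (gaussianReal 0 1) := hi3.const_mul _
    have j4 : Integrable (fun t => n * (Icc (-M) M)ᶜ.indicator (1 : ℝ → ℝ) t)
      (gaussianReal 0 1) := (hi2 M).const_mul _
    have j12 : Integrable (fun t => 2 * K / n * (Icc (-T) T).indicator V t +
      4 * M ^ 2 * (Icc (-T) T)ᶜ.indicator (1 : ℝ → ℝ) t) (gaussianReal 0 1) := j1.add j2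
    have j123 : Integrable (fun t => 2 * K / n * (Icc (-T) T).indicator V t +
      4 * M ^ 2 * (Icc (-T) T)ᶜ.indicator (1 : ℝ → ℝ) t + 1 / n * t ^ 4) (gaussianReal 0 1) :=
      j12.add j3
    simp only [hb]
    rw [integral_add j123 j4, integral_add j12 j3, integral_add j1 j2,
      integral_const_mul, integral_const_mul, integral_const_mul, integral_const_mul,
      integral_indicator_one measurableSet_Icc.compl, integral_indicator_one measurableSet_Icc.compl,
      integral_indicator measurableSet_Icc, integral_inv_stdNormalCDF_mul_one_sub hT0]
  calc _ ≤ ∫ t, b t ∂(gaussianReal 0 1) :=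
        integral_mono_of_nonneg (ae_of_all _ fun t => integral_nonneg fun y => sq_nonneg _) hbi
          (ae_of_all _ hpt)
    _ ≤ 2 * K / n * (2 * Real.log n) + 4 * M ^ 2 * (2 * (1 / n)) + 1 / n * 96 +
        n * (2 * (1 / (n : ℝ) ^ 2)) := by
        rw [hbint]
        have e1 : (gaussianReal 0 1).real (Icc (-T) T)ᶜ ≤ 2 * (1 / n) := by
          have := measureReal_compl_Icc_le T
          rwa [hT, sub_sub_cancel] at this
        have e2 : (gaussianReal 0 1).real (Icc (-M) M)ᶜ ≤ 2 * (1 / (n : ℝ) ^ 2) := by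
          have := measureReal_compl_Icc_le M
          rwa [stdNormalCDF_maxScore hn, sub_sub_cancel] at this
        have e3 : Real.log (stdNormalCDF T / (1 - stdNormalCDF T)) ≤ Real.log n := by
          rw [hT, sub_sub_cancel]
          apply Real.log_le_log
          · apply div_pos <;> linarith
          · rw [div_le_iff₀ hinv0]
            field_simp
            linarith
        have e4 := integral_pow_four_stdGaussian_le
        gcongr
    _ = _ := by field_simp; ring

/-! ### Concentration of the mean product of normal scores -/

/-- `n` times a bound for the mean square distance of an observation to its normal score. -/
noncomputable def scoreErrorConst (n : ℕ) : ℝ :=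
  4 * (18 * (1 + maxScore n) ^ 2) ^ 2 * Real.log n + 8 * maxScore n ^ 2 + 98

lemma scoreErrorConst_pos (n : ℕ) : 0 < scoreErrorConst n := by
  have := Real.log_natCast_nonneg n
  unfold scoreErrorConst
  positivity

lemma measurePreserving_pi_comp {α β : Type*} [MeasurableSpace α] [MeasurableSpace β] {n : ℕ}
    {γ : Measure α} [IsProbabilityMeasure γ] {η : Measure β} {g : α → β} (hg : Measurable g)
    (h : γ.map g = η) :
    MeasurePreserving (fun (z : Fin n → α) l => g (z l)) (Measure.pi fun _ => γ)
      (Measure.pi fun _ => η) := by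
  have : IsProbabilityMeasure (γ.map g) := Measure.isProbabilityMeasure_map hg.aemeasurable
  refine ⟨by fun_prop, ?_⟩
  rw [Measure.pi_map_pi fun _ => hg.aemeasurable, h]

section Bivariate

variable {n : ℕ} {γ : Measure (ℝ × ℝ)} [IsProbabilityMeasure γ]

/-- The mean product of the normal scores is almost unbiased for the correlation. -/
lemma abs_integral_rankProduct_sub_le (hn : 2 ≤ n) (h1 : γ.map Prod.fst = gaussianReal 0 1)
    (h2 : γ.map Prod.snd = gaussianReal 0 1) :
    |∫ z, rankProduct (normalScore n) z ∂(Measure.pi fun _ : Fin n => γ) - ∫ q, q.1 * q.2 ∂γ| ≤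
      (maxScore n + 1) * √(scoreErrorConst n / n) := by
  have hn0 : (0 : ℝ) < n := by positivity
  set M := maxScore n
  set D := scoreErrorConst n / n with hD
  have hD0 : 0 < D := div_pos (scoreErrorConst_pos n) hn0
  set s := √D
  have hs0 : 0 < s := Real.sqrt_pos.2 hD0
  have hsD : s ^ 2 = D := Real.sq_sqrt hD0.le
  set Γ : Measure (Fin n → ℝ × ℝ) := Measure.pi fun _ => γ
  have p1 := measurePreserving_pi_comp (n := n) measurable_fst h1
  have p2 := measurePreserving_pi_comp (n := n) measurable_snd h2
  have q1 : MeasurePreserving (Prod.fst : ℝ × ℝ → ℝ) γ (gaussianReal 0 1) := ⟨measurable_fst, h1⟩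
  have q2 : MeasurePreserving (Prod.snd : ℝ × ℝ → ℝ) γ (gaussianReal 0 1) := ⟨measurable_snd, h2⟩
  have hid : MemLp id 2 (gaussianReal 0 1) := memLp_id_gaussianReal' 2 (by norm_num)
  have m1 : MemLp (Prod.fst : ℝ × ℝ → ℝ) 2 γ := hid.comp_measurePreserving q1
  have m2 : MemLp (Prod.snd : ℝ × ℝ → ℝ) 2 γ := hid.comp_measurePreserving q2
  have hxy : Integrable (fun q : ℝ × ℝ => q.1 * q.2) γ := m1.integrable_mul m2
  have ev : ∀ i : Fin n, MeasurePreserving (fun z : Fin n → ℝ × ℝ => z i) Γ γ :=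
    fun i => measurePreserving_eval _ i
  set x : Fin n → (Fin n → ℝ × ℝ) → ℝ := fun i z => (z i).1
  set y : Fin n → (Fin n → ℝ × ℝ) → ℝ := fun i z => (z i).2
  set a : Fin n → (Fin n → ℝ × ℝ) → ℝ := fun i z => normalScore n (tieRank (fun l => (z l).1) i)
  set b : Fin n → (Fin n → ℝ × ℝ) → ℝ := fun i z => normalScore n (tieRank (fun l => (z l).2) i)
  have ham : ∀ i, Measurable (a i) := fun i => (measurable_comp_tieRank (normalScore n) i).comp p1.measurable
  have hbm : ∀ i, Measurable (b i) := fun i => (measurable_comp_tieRank (normalScore n) i).comp p2.measurable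
  have haM : ∀ i z, |a i z| ≤ M := fun i z => abs_normalScore_le hn _
  have hbM : ∀ i z, |b i z| ≤ M := fun i z => abs_normalScore_le hn _
  have hab : ∀ i, Integrable (fun z => a i z * b i z) Γ := fun i =>
    integrable_of_abs_le (B := M * M) ((ham i).mul (hbm i)) fun z => by
      rw [abs_mul]
      exact mul_le_mul (haM i z) (hbM i z) (abs_nonneg _) (maxScore_nonneg hn)
  have hxyi : ∀ i, Integrable (fun z => x i z * y i z) Γ := fun i =>
    (ev i).integrable_comp_of_integrable hxy
  have hxyint : ∀ i, ∫ z, x i z * y i z ∂Γ = ∫ q, q.1 * q.2 ∂γ := fun i =>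
    integral_comp_eval (μ := fun _ : Fin n => γ) (i := i) (f := fun q => q.1 * q.2)
      hxy.aestronglyMeasurable
  have hx2 : ∀ i, Integrable (fun z => x i z ^ 2) Γ := fun i =>
    ((ev i).integrable_comp_of_integrable m1.integrable_sq)
  have hx2int : ∀ i, ∫ z, x i z ^ 2 ∂Γ = 1 := fun i => by
    have e1 : ∫ z, x i z ^ 2 ∂Γ = ∫ q, q.1 ^ 2 ∂γ :=
      integral_comp_eval (μ := fun _ : Fin n => γ) (i := i) (f := fun q => q.1 ^ 2)
        m1.integrable_sq.aestronglyMeasurable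
    have e2 : ∫ q, q.1 ^ 2 ∂γ = ∫ t, t ^ 2 ∂(gaussianReal 0 1) := by
      rw [← h1, integral_map measurable_fst.aemeasurable]
      fun_prop
    have e3 := variance_fun_id_gaussianReal (μ := 0) (v := 1)
    rw [variance_eq_integral (by fun_prop), integral_id_gaussianReal] at e3
    rw [e1, e2]
    simpa using e3
  have hA : ∀ i, Integrable (fun z => (a i z - x i z) ^ 2) Γ ∧
      ∫ z, (a i z - x i z) ^ 2 ∂Γ ≤ D := fun i => by
    obtain ⟨g1, g2⟩ := integral_sq_normalScore_tieRank_sub_le hn i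
    refine ⟨p1.integrable_comp_of_integrable g1, ?_⟩
    rw [← p1.map_eq, integral_map p1.measurable.aemeasurable
      (by rw [p1.map_eq]; exact g1.aestronglyMeasurable)] at g2
    exact g2
  have hB : ∀ i, Integrable (fun z => (b i z - y i z) ^ 2) Γ ∧
      ∫ z, (b i z - y i z) ^ 2 ∂Γ ≤ D := fun i => by
    obtain ⟨g1, g2⟩ := integral_sq_normalScore_tieRank_sub_le hn i
    refine ⟨p2.integrable_comp_of_integrable g1, ?_⟩
    rw [← p2.map_eq, integral_map p2.measurable.aemeasurable
      (by rw [p2.map_eq]; exact g1.aestronglyMeasurable)] at g2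
    exact g2
  have hterm : ∀ i, |∫ z, (a i z * b i z - x i z * y i z) ∂Γ| ≤ (M + 1) * s := by
    intro i
    have hM0 : 0 ≤ M := maxScore_nonneg hn
    -- Young's inequality with weight `s = √D` replaces Cauchy–Schwarz: the weight balances both
    -- halves of each product, so the first difference costs `M s` and the second `s`, because `x i`
    -- has second moment 1.
    have hpt : ∀ z, |a i z * b i z - x i z * y i z| ≤
        (M * (s / 2) + M / (2 * s) * (a i z - x i z) ^ 2) +
          (s / 2 * x i z ^ 2 + 1 / (2 * s) * (b i z - y i z) ^ 2) := by
      intro z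
      have am : ∀ u v : ℝ, |u| * |v| ≤ s / 2 * u ^ 2 + 1 / (2 * s) * v ^ 2 := by
        intro u v
        have h : s / 2 * u ^ 2 + 1 / (2 * s) * v ^ 2 - |u| * |v| =
            1 / (2 * s) * (s * |u| - |v|) ^ 2 := by
          rw [← sq_abs u, ← sq_abs v]; field_simp; ring
        have : 0 ≤ 1 / (2 * s) * (s * |u| - |v|) ^ 2 := by positivity
        linarith
      have e : a i z * b i z - x i z * y i z =
          b i z * (a i z - x i z) + x i z * (b i z - y i z) := by ring
      rw [e]
      refine (abs_add_le _ _).trans (add_le_add ?_ ?_)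
      · rw [abs_mul]
        have h3 := am 1 (a i z - x i z)
        rw [abs_one, one_mul] at h3
        calc |b i z| * |a i z - x i z| ≤ M * (s / 2 * 1 ^ 2 + 1 / (2 * s) * (a i z - x i z) ^ 2) :=
              mul_le_mul (hbM i z) h3 (abs_nonneg _) hM0
          _ = _ := by ring
      · rw [abs_mul]; exact am _ _
    have i1 : Integrable (fun z => M * (s / 2) + M / (2 * s) * (a i z - x i z) ^ 2) Γ :=
      (integrable_const _).add ((hA i).1.const_mul _)
    have i2 : Integrable (fun z => s / 2 * x i z ^ 2 + 1 / (2 * s) * (b i z - y i z) ^ 2) Γ :=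
      ((hx2 i).const_mul _).add ((hB i).1.const_mul _)
    calc |∫ z, (a i z * b i z - x i z * y i z) ∂Γ|
        ≤ ∫ z, |a i z * b i z - x i z * y i z| ∂Γ := abs_integral_le_integral_abs
      _ ≤ ∫ z, ((M * (s / 2) + M / (2 * s) * (a i z - x i z) ^ 2) +
          (s / 2 * x i z ^ 2 + 1 / (2 * s) * (b i z - y i z) ^ 2)) ∂Γ :=
          integral_mono ((hab i).sub (hxyi i)).abs (i1.add i2) hpt
      _ = (M * (s / 2) + M / (2 * s) * ∫ z, (a i z - x i z) ^ 2 ∂Γ) +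
          (s / 2 * 1 + 1 / (2 * s) * ∫ z, (b i z - y i z) ^ 2 ∂Γ) := by
          rw [integral_add i1 i2, integral_add (integrable_const _) ((hA i).1.const_mul _),
            integral_add ((hx2 i).const_mul _) ((hB i).1.const_mul _),
            integral_const_mul (M / (2 * s)), integral_const_mul (s / 2),
            integral_const_mul (1 / (2 * s)), hx2int]
          simp
      _ ≤ (M * (s / 2) + M / (2 * s) * s ^ 2) + (s / 2 * 1 + 1 / (2 * s) * s ^ 2) := by
          rw [hsD]
          have := (hA i).2
          have := (hB i).2
          gcongr
      _ = (M + 1) * s := by field_simp; ring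
  have e : ∫ z, rankProduct (normalScore n) z ∂Γ - ∫ q, q.1 * q.2 ∂γ =
      (∑ i, ∫ z, (a i z * b i z - x i z * y i z) ∂Γ) / n := by
    have e1 : ∫ z, rankProduct (normalScore n) z ∂Γ = (∑ i, ∫ z, a i z * b i z ∂Γ) / n := by
      simp only [rankProduct]
      rw [integral_div, integral_finsetSum _ fun i _ => hab i]
    rw [e1]
    simp_rw [fun i => integral_sub (hab i) (hxyi i), hxyint]
    rw [Finset.sum_sub_distrib]
    simp only [Finset.sum_const, Finset.card_univ, Fintype.card_fin, nsmul_eq_mul]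
    field_simp
  rw [e, abs_div, abs_of_pos hn0, div_le_iff₀ hn0]
  calc _ ≤ ∑ i, |∫ z, (a i z * b i z - x i z * y i z) ∂Γ| := Finset.abs_sum_le_sum_abs _ _
    _ ≤ ∑ _i : Fin n, (M + 1) * s := Finset.sum_le_sum fun i _ => hterm i
    _ = _ := by simp [mul_comm]

/-- McDiarmid with `6M² / n ≤ 24 log n / n`, and `1152 = 2 · 24²`. -/
lemma measureReal_abs_rankProduct_sub_ge_le (hn : 2 ≤ n) {t : ℝ} (ht : 0 ≤ t) :
    (Measure.pi fun _ : Fin n => γ).real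
        {z | t ≤ |rankProduct (normalScore n) z -
          ∫ z, rankProduct (normalScore n) z ∂(Measure.pi fun _ : Fin n => γ)|} ≤
      2 * Real.exp (-(n * t ^ 2 / (1152 * Real.log n ^ 2))) := by
  have hn0 : (0 : ℝ) < n := by positivity
  have hL : 0 < Real.log n := Real.log_pos (by exact_mod_cast hn)
  have h := measureReal_abs_sub_integral_ge_le_of_bounded_differences γ
    (measurable_rankProduct (n := n) (normalScore n)) (abs_rankProduct_le (abs_normalScore_le hn))
    (c := 24 * Real.log n / n) (fun z i y => by
      refine (abs_rankProduct_update_sub_le (monotone_normalScore hn)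
        (abs_normalScore_le hn) z i y).trans ?_
      have := maxScore_sq_le hn
      exact div_le_div_of_nonneg_right (by linarith) hn0.le) ht
  refine h.trans (le_of_eq ?_)
  congr 2
  field_simp
  ring

/-- Concentration of the centred mean product of normal scores around the correlation. -/
lemma measureReal_abs_rankProduct_sub_correlation_le (hn : 2 ≤ n)
    (h1 : γ.map Prod.fst = gaussianReal 0 1) (h2 : γ.map Prod.snd = gaussianReal 0 1) {ε : ℝ}
    (hε : 2 * ((maxScore n / n) ^ 2 + (maxScore n + 1) * √(scoreErrorConst n / n)) ≤ ε) :
    (Measure.pi fun _ : Fin n => γ).real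
        {z | ε < |rankProduct (normalScore n) z - (maxScore n / n) ^ 2 - ∫ q, q.1 * q.2 ∂γ|} ≤
      2 * Real.exp (-(n * ε ^ 2 / (4608 * Real.log n ^ 2))) := by
  have hb := abs_integral_rankProduct_sub_le hn h1 h2
  have hM := maxScore_nonneg hn
  have hε0 : 0 ≤ ε := le_trans (by positivity) hε
  calc _ ≤ _ := measureReal_mono (fun z hz => ?_)
    -- Half of `ε` pays for the bias and the centring term, leaving a deviation of `ε / 2`; hence
    -- `4608 = 4 · 1152`.
    _ ≤ _ := measureReal_abs_rankProduct_sub_ge_le (γ := γ) hn (t := ε / 2) (by linarith)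
    _ = _ := by ring_nf
  simp only [mem_ofPred_eq] at hz ⊢
  set E := ∫ z, rankProduct (normalScore n) z ∂(Measure.pi fun _ : Fin n => γ)
  have e : rankProduct (normalScore n) z - (maxScore n / n) ^ 2 - ∫ q, q.1 * q.2 ∂γ =
      (rankProduct (normalScore n) z - E) + ((E - ∫ q, q.1 * q.2 ∂γ) - (maxScore n / n) ^ 2) := by
    ring
  rw [e] at hz
  have h3 := abs_add_le (rankProduct (normalScore n) z - E)
    ((E - ∫ q, q.1 * q.2 ∂γ) - (maxScore n / n) ^ 2)
  have h4 := abs_sub (E - ∫ q, q.1 * q.2 ∂γ) ((maxScore n / n) ^ 2)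
  rw [abs_of_nonneg (sq_nonneg (maxScore n / n))] at h4
  linarith

end Bivariate

/-- Up to logarithmic factors the bias is of order `n ^ (-1 / 2)`. -/
lemma bias_le {n : ℕ} (hn : 3 ≤ n) :
    (maxScore n / n) ^ 2 + (maxScore n + 1) * √(scoreErrorConst n / n) ≤
      1000 * Real.log n ^ 4 / √n := by
  have hn0 : (0 : ℝ) < n := by positivity
  have hn3 : (3 : ℝ) ≤ n := by exact_mod_cast hn
  set L := Real.log n
  have hL : 1 ≤ L := by
    rw [Real.le_log_iff_exp_le hn0]
    exact Real.exp_one_lt_three.le.trans hn3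
  have hM0 := maxScore_nonneg (n := n) (by omega)
  have hM2 : maxScore n ^ 2 ≤ 4 * L := maxScore_sq_le (by omega)
  have hM : maxScore n ≤ 2 * L := by nlinarith
  set M := maxScore n
  have hpow : ∀ a b : ℕ, a ≤ b → L ^ a ≤ L ^ b := fun a b hab => pow_le_pow_right₀ hL hab
  -- As `L ≥ 1`, all terms may be raised to `L ^ 6`, and `330² = 108900` exceeds `104976 + 32 + 98`.
  have hD : scoreErrorConst n ≤ (330 * L ^ 3) ^ 2 := by
    have hK : (18 * (1 + M) ^ 2) ^ 2 ≤ (18 * (3 * L) ^ 2) ^ 2 := by gcongr; linarith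
    have h5 := hpow 5 6 (by norm_num)
    have h1 := hpow 1 6 (by norm_num)
    have h0 := hpow 0 6 (by norm_num)
    rw [pow_one] at h1
    rw [pow_zero] at h0
    calc scoreErrorConst n ≤ 4 * (18 * (3 * L) ^ 2) ^ 2 * L + 8 * (4 * L) + 98 := by
          unfold scoreErrorConst; gcongr
      _ = 104976 * L ^ 5 + 32 * L + 98 := by ring
      _ ≤ (330 * L ^ 3) ^ 2 := by nlinarith
  have hsq : √(scoreErrorConst n / n) ≤ 330 * L ^ 3 / √n := by
    rw [Real.sqrt_div (scoreErrorConst_pos n).le]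
    gcongr
    exact Real.sqrt_le_iff.2 ⟨by positivity, hD⟩
  have hfirst : (M / n) ^ 2 ≤ 4 * L ^ 4 / √n := by
    rw [div_pow]
    have h14 := hpow 1 4 (by norm_num)
    rw [pow_one] at h14
    have : √(n : ℝ) ≤ (n : ℝ) ^ 2 := by
      rw [Real.sqrt_le_left (by positivity)]
      nlinarith [pow_le_pow_right₀ (show (1 : ℝ) ≤ n by linarith) (show 1 ≤ 4 by norm_num)]
    gcongr
    linarith
  calc _ ≤ 4 * L ^ 4 / √n + (2 * L + L) * (330 * L ^ 3 / √n) := by gcongr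
    _ = 994 * L ^ 4 / √n := by ring
    _ ≤ _ := by gcongr; norm_num

/-! ### The estimators as functions of the ranks -/

section Copula

variable {p n : ℕ} {ν : Measure (Fin p → ℝ)}

/-- Nonzero values exclude the default of the quantile function at 0 and 1, so `F_j` stays in `(0,
1)` between `s` and `t`, where the quantile function is monotone. -/
lemma trans_mono_of_ne_zero {j : Fin p} {s t : ℝ} (hs : trans ν j s ≠ 0) (ht : trans ν j t ≠ 0)
    (hst : s ≤ t) : trans ν j s ≤ trans ν j t := by
  have h0 : 0 < marginalCDF ν j s := by
    refine lt_of_le_of_ne (cdf_nonneg _ _) fun h => hs ?_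
    rw [trans, ← h, stdNormalQuantile_zero]
  have h1 : marginalCDF ν j t < 1 := by
    refine lt_of_le_of_ne (cdf_le_one _ _) fun h => ht ?_
    rw [trans, h, stdNormalQuantile_one]
  exact stdNormalQuantile_mono h0 (monotone_cdf _ hst) h1

/-- Along the sample `h_j` is monotone and injective, so it preserves ranks; the empirical
distribution function at an observation is its rank over `n`. -/
lemma estTrans_eq_normalScore {x : Fin n → Fin p → ℝ} {j : Fin p}
    (hinj : Function.Injective fun i => trans ν j (x i j)) (hne : ∀ i, trans ν j (x i j) ≠ 0)
    (i : Fin n) :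
    estTrans x j (x i j) = normalScore n (tieRank (fun l => trans ν j (x l j)) i) := by
  have h : (Finset.univ.filter fun l => x l j ≤ x i j) =
      Finset.univ.filter fun l => trans ν j (x l j) ≤ trans ν j (x i j) := by
    ext l
    simp only [Finset.mem_filter, Finset.mem_univ, true_and]
    refine ⟨trans_mono_of_ne_zero (hne l) (hne i), fun hle => ?_⟩
    by_contra hlt
    have h2 := trans_mono_of_ne_zero (hne i) (hne l) (not_le.1 hlt).le
    have := hinj (le_antisymm hle h2)
    exact hlt (this ▸ le_rfl)
  rw [tieRank_eq_of_injective hinj, ← h]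
  rfl

lemma sampleMean_eq (hn : 2 ≤ n) {x : Fin n → Fin p → ℝ} {j : Fin p}
    (hinj : Function.Injective fun i => trans ν j (x i j)) (hne : ∀ i, trans ν j (x i j) ≠ 0) :
    sampleMean x j = maxScore n / n := by
  rw [sampleMean, Finset.sum_congr rfl fun i _ => estTrans_eq_normalScore hinj hne i,
    sum_comp_tieRank, sum_normalScore hn]

lemma sampleCov_eq (hn : 2 ≤ n) {x : Fin n → Fin p → ℝ} {j k : Fin p}
    (hinj : Function.Injective fun i => trans ν j (x i j)) (hne : ∀ i, trans ν j (x i j) ≠ 0)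
    (hinj' : Function.Injective fun i => trans ν k (x i k)) (hne' : ∀ i, trans ν k (x i k) ≠ 0) :
    sampleCov x j k =
      rankProduct (normalScore n) (fun i => (trans ν j (x i j), trans ν k (x i k))) -
        (maxScore n / n) ^ 2 := by
  have hn0 : (n : ℝ) ≠ 0 := by positivity
  have e : ∀ i, (estTrans x j (x i j) - sampleMean x j) * (estTrans x k (x i k) - sampleMean x k) =
      estTrans x j (x i j) * estTrans x k (x i k) - sampleMean x k * estTrans x j (x i j) -
        sampleMean x j * estTrans x k (x i k) + sampleMean x j * sampleMean x k := fun i => by ring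
  have hs : ∀ l, ∑ i, estTrans x l (x i l) = n * sampleMean x l := fun l => by
    rw [sampleMean]; field_simp
  rw [sampleCov, Finset.sum_congr rfl fun i _ => e i, Finset.sum_add_distrib,
    Finset.sum_sub_distrib, Finset.sum_sub_distrib, ← Finset.mul_sum, ← Finset.mul_sum, hs, hs,
    sampleMean_eq hn hinj hne, sampleMean_eq hn hinj' hne', rankProduct,
    Finset.sum_congr rfl fun i _ => by
      rw [estTrans_eq_normalScore hinj hne i, estTrans_eq_normalScore hinj' hne' i]]
  simp only [Finset.sum_const, Finset.card_univ, Fintype.card_fin, nsmul_eq_mul]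
  field_simp
  ring

/-- The pair of transformed features `(h_j(x_j), h_k(x_k))`. -/
noncomputable def transPair (ν : Measure (Fin p → ℝ)) (j k : Fin p) (x : Fin p → ℝ) : ℝ × ℝ :=
  (trans ν j (x j), trans ν k (x k))

/-! ### Laws of the transformed pairs and of the transformed sample -/

section Law

variable {S : Matrix (Fin p) (Fin p) ℝ} (hS : S.PosSemidef) (hdiag : ∀ j, S j j = 1)
  (hlaw : HasLaw (transVec ν) (multivariateGaussian 0 S) ν)

include hlaw in
lemma aemeasurable_transPair (j k : Fin p) : AEMeasurable (transPair ν j k) ν := by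
  have hm : Measurable fun v : EuclideanSpace ℝ (Fin p) => (v j, v k) := by fun_prop
  exact hm.comp_aemeasurable hlaw.aemeasurable

include hlaw in
lemma map_transPair (j k : Fin p) :
    ν.map (transPair ν j k) = (multivariateGaussian 0 S).map fun v => (v j, v k) := by
  have hm : Measurable fun v : EuclideanSpace ℝ (Fin p) => (v j, v k) := by fun_prop
  rw [← hlaw.map_eq, AEMeasurable.map_map_of_aemeasurable hm.aemeasurable hlaw.aemeasurable]
  rfl

include hS hdiag in
lemma measurePreserving_coord_multivariateGaussian (j : Fin p) :
    MeasurePreserving (fun v : EuclideanSpace ℝ (Fin p) => v j) (multivariateGaussian 0 S)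
      (gaussianReal 0 1) := by
  have := measurePreserving_eval_multivariateGaussian (μ := 0) hS (i := j)
  simpa [hdiag j] using this

include hS hdiag hlaw in
lemma map_fst_transPair (j k : Fin p) :
    (ν.map (transPair ν j k)).map Prod.fst = gaussianReal 0 1 := by
  rw [map_transPair hlaw, Measure.map_map measurable_fst (by fun_prop)]
  exact (measurePreserving_coord_multivariateGaussian hS hdiag j).map_eq

include hS hdiag hlaw in
lemma map_snd_transPair (j k : Fin p) :
    (ν.map (transPair ν j k)).map Prod.snd = gaussianReal 0 1 := by
  rw [map_transPair hlaw, Measure.map_map measurable_snd (by fun_prop)]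
  exact (measurePreserving_coord_multivariateGaussian hS hdiag k).map_eq

include hS hdiag hlaw in
lemma integral_mul_transPair (j k : Fin p) :
    ∫ q, q.1 * q.2 ∂(ν.map (transPair ν j k)) = S j k := by
  have hL : ∀ j, MemLp (fun v : EuclideanSpace ℝ (Fin p) => v j) 2 (multivariateGaussian 0 S) :=
    fun j => (memLp_id_gaussianReal' 2 (by norm_num)).comp_measurePreserving
      (measurePreserving_coord_multivariateGaussian hS hdiag j)
  have h0 : ∀ j, ∫ v, v j ∂(multivariateGaussian 0 S) = 0 := fun j => by
    have h := measurePreserving_coord_multivariateGaussian hS hdiag j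
    have h2 : ∫ t, t ∂(gaussianReal 0 1) = 0 := integral_id_gaussianReal
    rwa [← h.map_eq, integral_map h.measurable.aemeasurable (by fun_prop)] at h2
  have hc := covariance_eval_multivariateGaussian (μ := 0) hS j k
  rw [covariance_eq_sub (hL j) (hL k), h0 j, h0 k, mul_zero, sub_zero] at hc
  rw [map_transPair hlaw, integral_map (by fun_prop) (by fun_prop)]
  exact hc

variable {Ω : Type*} [MeasurableSpace Ω] {P : Measure Ω}
  {X : Fin n → Ω → Fin p → ℝ} (hX : ∀ i, Measurable (X i)) (hind : iIndepFun X P)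
  (hXν : ∀ i, P.map (X i) = ν)

include hlaw hX hXν in
lemma aemeasurable_transPair_sample (j k : Fin p) (i : Fin n) :
    AEMeasurable (fun ω => transPair ν j k (X i ω)) P := by
  have h := aemeasurable_transPair hlaw j k
  exact AEMeasurable.comp_aemeasurable (by rwa [hXν i]) (hX i).aemeasurable

variable [IsProbabilityMeasure P]

include hlaw hX hind hXν in
lemma map_transPair_sample (j k : Fin p) :
    P.map (fun ω i => transPair ν j k (X i ω)) =
      Measure.pi fun _ : Fin n => ν.map (transPair ν j k) := by
  have h := aemeasurable_transPair hlaw j k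
  have hc := hind.comp₀ (fun _ => transPair ν j k) (fun i => (hX i).aemeasurable)
    (fun i => by rwa [hXν i])
  have := (iIndepFun_iff_map_fun_eq_pi_map
    (fun i => aemeasurable_transPair_sample hlaw hX hXν j k i)).1 hc
  refine this.trans ?_
  congr 1
  ext1 i
  change P.map (transPair ν j k ∘ X i) = _
  rw [← AEMeasurable.map_map_of_aemeasurable (by rwa [hXν i]) (hX i).aemeasurable, hXν i]

include hS hdiag hlaw hX hind hXν in
/-- Almost surely the transformed sample has neither ties nor vanishing entries. -/
lemma ae_injective_and_ne_zero [IsProbabilityMeasure ν] (j : Fin p) :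
    ∀ᵐ ω ∂P, (Function.Injective fun i => trans ν j (X i ω j)) ∧
      ∀ i, trans ν j (X i ω j) ≠ 0 := by
  have hpm : IsProbabilityMeasure (ν.map (transPair ν j j)) :=
    Measure.isProbabilityMeasure_map (aemeasurable_transPair hlaw j j)
  have hmp := measurePreserving_pi_comp (n := n) measurable_fst
    (map_fst_transPair hS hdiag hlaw j j)
  have hae : AEMeasurable (fun ω i => transPair ν j j (X i ω)) P :=
    aemeasurable_pi_lambda _ fun i => aemeasurable_transPair_sample hlaw hX hXν j j i
  have hne : ∀ᵐ z ∂(Measure.pi fun _ : Fin n => gaussianReal 0 1), ∀ i, z i ≠ 0 := by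
    -- Zero is the default value of the quantile function, and the Gaussian has no atom there.
    rw [ae_all_iff]
    intro i
    have h : ∀ᵐ t ∂(gaussianReal 0 1), t ≠ 0 := by
      rw [ae_iff]; simp
    exact (measurePreserving_eval (fun _ : Fin n => gaussianReal 0 1) i).quasiMeasurePreserving.ae h
  have h2 := hmp.quasiMeasurePreserving.ae (ae_injective_pi.and hne)
  rw [← map_transPair_sample hlaw hX hind hXν j j] at h2
  exact ae_of_ae_map hae h2

include hS hdiag hlaw hX hind hXν in
-- The sample mean is almost surely the constant `maxScore n / n`, so the event is null once `ε`
-- reaches it.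
lemma measureReal_sampleMean_le [IsProbabilityMeasure ν] (hn : 2 ≤ n) (j : Fin p) {ε : ℝ}
    (hε : maxScore n / n ≤ ε) :
    P.real {ω | ε < |sampleMean (fun i => X i ω) j|} = 0 := by
  rw [measureReal_eq_zero_iff]
  have h : ∀ᵐ ω ∂P, ¬ ε < |sampleMean (fun i => X i ω) j| := by
    filter_upwards [ae_injective_and_ne_zero hS hdiag hlaw hX hind hXν j] with ω hω
    rw [sampleMean_eq hn hω.1 hω.2,
      abs_of_nonneg (div_nonneg (maxScore_nonneg hn) (Nat.cast_nonneg n))]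
    exact not_lt.2 hε
  simpa [ae_iff] using h

include hS hdiag hlaw hX hind hXν in
lemma measureReal_sampleCov_le [IsProbabilityMeasure ν] (hn : 3 ≤ n) (j k : Fin p) {ε : ℝ}
    (hε : 2000 * Real.log n ^ 4 / √n ≤ ε) :
    P.real {ω | ε < |sampleCov (fun i => X i ω) j k - S j k|} ≤
      2 * Real.exp (-(n * ε ^ 2 / (4608 * Real.log n ^ 2))) := by
  have hn2 : 2 ≤ n := by omega
  have hpm : IsProbabilityMeasure (ν.map (transPair ν j k)) :=
    Measure.isProbabilityMeasure_map (aemeasurable_transPair hlaw j k)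
  have hb := measureReal_abs_rankProduct_sub_correlation_le (γ := ν.map (transPair ν j k)) hn2
    (map_fst_transPair hS hdiag hlaw j k) (map_snd_transPair hS hdiag hlaw j k) (ε := ε) (by
      have := bias_le hn
      calc _ ≤ 2 * (1000 * Real.log n ^ 4 / √n) := by linarith
        _ = 2000 * Real.log n ^ 4 / √n := by ring
        _ ≤ ε := hε)
  rw [integral_mul_transPair hS hdiag hlaw, ← map_transPair_sample hlaw hX hind hXν j k,
    map_measureReal_apply_of_aemeasurable
      (aemeasurable_pi_lambda _ fun i => aemeasurable_transPair_sample hlaw hX hXν j k i)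
      (measurableSet_lt measurable_const
        (((measurable_rankProduct _).sub_const _).sub_const _).abs)] at hb
  refine le_trans (le_of_eq (measureReal_congr ?_)) hb
  filter_upwards [ae_injective_and_ne_zero hS hdiag hlaw hX hind hXν j,
    ae_injective_and_ne_zero hS hdiag hlaw hX hind hXν k] with ω hj hk
  have := sampleCov_eq hn2 hj.1 hj.2 hk.1 hk.2
  simp only [eq_iff_iff]
  change ε < |_| ↔ ε < |_|
  rw [this]
  rfl

end Law

end Copula

/-! ### Comparison with the bounds `ζ₁*` and `ζ₂*` -/

/-- The power `(log n)^10` is negligible against `n ^ (2ρ)`. The threshold depends on `ρ`, which is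
why `ε₀` does; the power 5 is the 4 of the bias plus the `log n` in the exponent of `ζ₂*`. -/
lemma exists_forall_log_pow_le {ρ : ℝ} (hρ : 0 < ρ) :
    ∃ n₀ : ℕ, 3 ≤ n₀ ∧ ∀ n : ℕ, n₀ ≤ n →
      (2000 * Real.log n ^ 5) ^ 2 ≤ ρ ^ 2 * (n : ℝ) ^ (2 * ρ) := by
  have h := (isLittleO_log_rpow_rpow_atTop (s := 2 * ρ) 10 (by positivity)).bound
    (show 0 < ρ ^ 2 / 2000 ^ 2 by positivity)
  obtain ⟨n₀, hn₀⟩ := eventually_atTop.1 (tendsto_natCast_atTop_atTop.eventually h)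
  refine ⟨max n₀ 3, le_max_right _ _, fun n hn => ?_⟩
  have := hn₀ n ((le_max_left _ _).trans hn)
  have hlog := Real.log_natCast_nonneg n
  rw [Real.norm_of_nonneg (by positivity), Real.norm_of_nonneg (by positivity),
    show (10 : ℝ) = (10 : ℕ) by norm_num, Real.rpow_natCast, div_mul_eq_mul_div,
    le_div_iff₀ (by positivity)] at this
  calc _ = Real.log n ^ 10 * 2000 ^ 2 := by ring
    _ ≤ _ := this

/-- For showing that a bound is vacuous: `exp t ≥ 1 + t ≥ 1 / 2`. -/
lemma one_le_mul_exp {a t : ℝ} (ha : 2 ≤ a) (ht : -(1 / 2) ≤ t) : 1 ≤ a * Real.exp t := by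
  have h1 := Real.add_one_le_exp t
  nlinarith

end GaussianCopula

open GaussianCopula in
theorem theorem1 :
    ∃ (c C : ℝ) (N : ℕ), 0 < c ∧ 0 < C ∧
      ∀ ρ : ℝ, 0 < ρ → ρ < 1 / 3 →
        ∃ ε₀ : ℝ, 0 < ε₀ ∧
          ∀ (p : ℕ) (ν : Measure (Fin p → ℝ)) (μ : EuclideanSpace ℝ (Fin p))
            (S : Matrix (Fin p) (Fin p) ℝ),
            IsProbabilityMeasure ν → μ = 0 → S.PosSemidef → (∀ j, S j j = 1) →
            HasLaw (transVec ν) (multivariateGaussian μ S) ν →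
            ∀ (n : ℕ), N ≤ n →
            ∀ (Ω : Type*) (_ : MeasurableSpace Ω) (P : Measure Ω) (X : Fin n → Ω → Fin p → ℝ),
              IsProbabilityMeasure P → (∀ i, Measurable (X i)) → iIndepFun X P →
              (∀ i, P.map (X i) = ν) →
              ∀ ε : ℝ, 0 < ε → ε < ε₀ →
                (∀ j, P.real {ω | ε < |sampleMean (fun i => X i ω) j - μ j|} ≤ zetaOne c n ρ ε) ∧
                (∀ j k, P.real {ω | ε < |sampleCov (fun i => X i ω) j k - S j k|}
                  ≤ zetaTwo C c n ρ ε) := by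
  refine ⟨1 / 8, 3, 2, by norm_num, by norm_num, fun ρ hρ _ => ?_⟩
  obtain ⟨n₀, hn₀3, hn₀⟩ := exists_forall_log_pow_le hρ
  -- This `ε₀` forces `n ε² ≤ 1` for all `n < n₀`, so there the first exponential of `ζ₂*` exceeds
  -- the trivial bound 1.
  refine ⟨1 / (n₀ + 1), by positivity, ?_⟩
  intro p ν μ S hν hμ hS hdiag hlaw n hn Ω _ P X hP hX hind hXν ε hε hε₀
  subst hμ
  have hn0 : (0 : ℝ) < n := by positivity
  refine ⟨fun j => ?_, fun j k => ?_⟩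
  · have hz : 0 ≤ zetaOne (1 / 8) n ρ ε := by unfold zetaOne; positivity
    simp only [PiLp.zero_apply, sub_zero]
    rcases le_or_gt (maxScore n / n) ε with h | h
    · rw [measureReal_sampleMean_le hS hdiag hlaw hX hind hXν hn j h]
      exact hz
    -- Otherwise `(ε n)² ≤ M² ≤ 4 log n ≤ 4n`, so `n ε² ≤ 4`; with `c = 1 / 8` the first term of
    -- `ζ₁*` is then at least 1.
    · have hM := maxScore_sq_le hn
      have hlog : Real.log n ≤ n := (Real.log_le_sub_one_of_pos hn0).trans (by linarith)
      have h1 : ε * n < maxScore n := (lt_div_iff₀ hn0).1 h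
      have h2 : (ε * n) ^ 2 ≤ maxScore n ^ 2 := by gcongr
      have h3 : n * ε ^ 2 ≤ 4 := by
        have : n * (n * ε ^ 2) ≤ n * 4 := by nlinarith
        exact le_of_mul_le_mul_left this hn0
      have h4 := one_le_mul_exp (a := 2) (t := -(1 / 8) * n * ε ^ 2) le_rfl (by linarith)
      refine measureReal_le_one.trans ?_
      unfold zetaOne
      have := Real.exp_pos (-(1 / 8) * (n : ℝ) ^ (1 - 2 * ρ) * ε ^ 2 / ρ)
      have := Real.exp_pos (-(1 / 8) * (n : ℝ) ^ (1 / 2 - ρ))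
      linarith
  · have hx1 := Real.exp_pos (-(1 / 8) * n * ε ^ 2)
    have hx2 := Real.exp_pos (-(1 / 8) * (n : ℝ) ^ (1 / 3 - ρ))
    have hx3 := Real.exp_pos (-(1 / 8) * (n : ℝ) ^ (1 - ρ))
    have hx4 := Real.exp_pos
      (-(1 / 8) * (Real.log n) ^ 2 * (n : ℝ) ^ (1 - 2 * ρ) * ε ^ 2 / ρ ^ 2)
    unfold zetaTwo
    rcases lt_or_ge n n₀ with hlt | hge
    · refine measureReal_le_one.trans ?_
      have h1 : n * ε ^ 2 ≤ 1 := by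
        have hnn : (n : ℝ) ≤ n₀ + 1 := by
          have : (n : ℝ) ≤ n₀ := by exact_mod_cast hlt.le
          linarith
        have h2 : ε * (n₀ + 1) < 1 := (lt_div_iff₀ (by positivity)).1 hε₀
        have h3 : ε < 1 := by
          have : (0 : ℝ) ≤ n₀ := Nat.cast_nonneg _
          nlinarith
        calc n * ε ^ 2 = (ε * n) * ε := by ring
          _ ≤ (ε * (n₀ + 1)) * 1 := by gcongr
          _ ≤ 1 := by linarith
      have := one_le_mul_exp (a := 3) (t := -(1 / 8) * n * ε ^ 2) (by norm_num) (by linarith)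
      linarith
    · have hn3 : 3 ≤ n := hn₀3.trans hge
      have hL : 1 ≤ Real.log n := by
        rw [Real.le_log_iff_exp_le hn0]
        exact Real.exp_one_lt_three.le.trans (by exact_mod_cast hn3)
      have hpow := hn₀ n hge
      set L := Real.log n
      have hsplit : (n : ℝ) ^ (1 - 2 * ρ) * (n : ℝ) ^ (2 * ρ) = n := by
        rw [← Real.rpow_add hn0]; simp
      have hr0 : 0 < (n : ℝ) ^ (1 - 2 * ρ) := by positivity
      have hr1 : 0 < (n : ℝ) ^ (2 * ρ) := by positivity
      set r := (n : ℝ) ^ (1 - 2 * ρ)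
      set q := (n : ℝ) ^ (2 * ρ)
      -- The threshold is twice the bias bound: above it concentration applies, below it the last
      -- term of `ζ₂*` is at least 1.
      rcases le_or_gt (2000 * L ^ 4 / √n) ε with h | h
      · refine (measureReal_sampleCov_le hS hdiag hlaw hX hind hXν hn3 j k h).trans ?_
        have hexp : Real.exp (-(n * ε ^ 2 / (4608 * L ^ 2))) ≤
            Real.exp (-(1 / 8) * L ^ 2 * r * ε ^ 2 / ρ ^ 2) := by
          rw [Real.exp_le_exp, neg_mul, neg_mul, neg_mul, neg_div, neg_le_neg_iff,
            div_le_div_iff₀ (by positivity) (by positivity), ← hsplit]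
          -- Here `576 = 4608 / 8` is what comparing the two exponents requires.
          have h1 : 576 * L ^ 4 ≤ ρ ^ 2 * q := by
            have : L ^ 4 ≤ L ^ 10 := pow_le_pow_right₀ hL (by norm_num)
            nlinarith [pow_pos (zero_lt_one.trans_le hL) 4]
          have h2 : 0 ≤ r * ε ^ 2 := by positivity
          nlinarith [mul_le_mul_of_nonneg_left h1 h2]
        linarith
      · refine measureReal_le_one.trans ?_
        have hsn : 0 < √(n : ℝ) := Real.sqrt_pos.2 hn0
        have h1 : ε * √n < 2000 * L ^ 4 := (lt_div_iff₀ hsn).1 h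
        have h2 : ε ^ 2 * n ≤ (2000 * L ^ 4) ^ 2 := by
          have : (ε * √n) ^ 2 ≤ (2000 * L ^ 4) ^ 2 := by gcongr
          rwa [mul_pow, Real.sq_sqrt hn0.le] at this
        have h3 : L ^ 2 * r * ε ^ 2 / ρ ^ 2 ≤ 1 := by
          rw [div_le_one (by positivity)]
          have h4 : q * (L ^ 2 * r * ε ^ 2) ≤ q * ρ ^ 2 := by
            calc q * (L ^ 2 * r * ε ^ 2) = L ^ 2 * (ε ^ 2 * (r * q)) := by ring
              _ ≤ L ^ 2 * (2000 * L ^ 4) ^ 2 := by rw [hsplit]; gcongr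
              _ = (2000 * L ^ 5) ^ 2 := by ring
              _ ≤ q * ρ ^ 2 := by rw [mul_comm q]; exact hpow
          exact le_of_mul_le_mul_left h4 hr1
        have := one_le_mul_exp (a := 3) (t := -(1 / 8) * L ^ 2 * r * ε ^ 2 / ρ ^ 2) (by norm_num)
          (by
            have e : -(1 / 8) * L ^ 2 * r * ε ^ 2 / ρ ^ 2 = -(1 / 8) * (L ^ 2 * r * ε ^ 2 / ρ ^ 2) := by
              ring
            rw [e]; linarith)
        linarith
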